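/- Let $\mathbb T=\mathbb R/\mathbb Z$, represented by $(-\frac12,\frac12]$, let $\omega(k)=|\sin(\pi k)|$, and let $$V(k)=\omega(k)^2\int_{\mathbb T}\int_{\mathbb T}\delta\big(\omega(k)+\omega(k_1)-\omega(k')-\omega(k+k_1-k')\big)\,dk_1\,dk'$$ be the collision frequency, where the inner integral is $\int\delta(g(k_1))\,dk_1=\sum 1/|g'(k_1)|$, the sum running over the zeros $k_1$ of $g(k_1)=\omega(k)+\omega(k_1)-\omega(k')-\omega(k+k_1-k')$ other than the trivial ones ($k'=k$ or $k'=k_1$ modulo $1$). Then $V(k)<\infty$ for every $k$, and the limit $$v_0=\lim_{k\to0}|\sin(\pi k)|^{-5/3}V(k)$$ exists and lies in $(0,\infty)$. For $\varepsilon>0$, $p>0$, $\xi\in\mathbb R$ put $$a_1^\varepsilon(p,\xi)=\varepsilon^{-8/5}\int_{\mathbb T}D(k)\,V(k)\,dk,\qquad a_2^\varepsilon(p,\xi)=\varepsilon^{-8/5}\int_{\mathbb T}D(k)\,\frac{\varepsilon^{3/5}V(k)}{\omega(k)}\,dk,\qquad a_3^\varepsilon(p,\xi)=\varepsilon^{-1}\int_{\mathbb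 T}D(k)\,\frac{\varepsilon^{3/5}V(k)}{\omega(k)^2}\,dk,$$ $$\text{where}\quad D(k)=\frac{V(k)}{\varepsilon^{8/5}p+V(k)+i\varepsilon\omega'(k)\xi}-1 .$$ These integrals converge absolutely, and, as $\varepsilon\to0^+$, pointwise for $(p,\xi)\in(0,\infty)\times\mathbb R$ and strongly in $L^q_{loc}((0,\infty)\times\mathbb R)$ for all $q\in(1,\infty)$, $$a_1^\varepsilon(p,\xi)\to-p-\kappa_1|\xi|^{8/5},\qquad a_2^\varepsilon(p,\xi)\to-\kappa_2|\xi|,\qquad a_3^\varepsilon(p,\xi)\to-\kappa_3|\xi|^{2/5},$$ where $$\kappa_1=\frac65\Big(\frac{\pi}{v_0}\Big)^{3/5}\int_0^\infty\frac{z^{3/5}}{z^2+1}\,dz,\qquad \kappa_2=\frac65\int_0^\infty\frac{dz}{z^2+1},\qquad \kappa_3=\frac65\Big(\frac{v_0}{\pi}\Big)^{3/5}\int_0^\infty\frac{z^{-3/5}}{z^2+1}\,dz,$$ all three integrals being convergent. Furthermore $a_1^\varepsilon,a_2^\varepsilon,a_3^\varepsilon$ belong to $L^\infty_{loc}((0,\infty)\times\mathbb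 R)$ uniformly with respect to $\varepsilon$: for every compact $K\subset(0,\infty)\times\mathbb R$ there is a constant $C$ with $\|a_i^\varepsilon\|_{L^\infty(K)}\le C$ for all $\varepsilon>0$ and $i=1,2,3$. -/

import Mathlib

open Real Set Filter Topology MeasureTheory
open scoped ENNReal

noncomputable section

namespace PhononSymbol

/-- Dispersion relation `ω(k) = |sin (π k)|`, as a 1-periodic function on `ℝ`. The torus `ℝ/ℤ` is
represented throughout by the fundamental domain `(-1/2, 1/2]`. -/
def omega (k : ℝ) : ℝ := |sin (π * k)|

/-- `∫_Z δ(g(z)) dz = ∑_{z ∈ Z, g z = 0} 1 / |g'(z)|`, with values in `[0, ∞]`. -/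
def deltaIntegral (g : ℝ → ℝ) (Z : Set ℝ) : ℝ≥0∞ :=
  ∑' z : {z : ℝ // z ∈ Z ∧ g z = 0}, (ENNReal.ofReal |deriv g z|)⁻¹

/-- Energy defect `ω(k) + ω(k₁) - ω(k') - ω(k + k₁ - k')` of a four-phonon collision. -/
def energyDefect (k k₁ k' : ℝ) : ℝ :=
  omega k + omega k₁ - omega k' - omega (k + k₁ - k')

/-- The `k₁` in the torus for which the collision `(k, k₁) → (k', k + k₁ - k')` is not a trivial one,
that is, neither `k' = k` nor `k' = k₁` holds modulo 1. (Trivial collisions conserve energy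
identically, do not contribute to the collision operator, and are left out of the collision rate.) -/
def nontrivialPartners (k k' : ℝ) : Set ℝ :=
  {k₁ | k₁ ∈ Ioc (-(1 / 2) : ℝ) (1 / 2) ∧
    (∀ n : ℤ, k' - k ≠ n) ∧ (∀ n : ℤ, k' - k₁ ≠ n)}

/-- The collision frequency
`V(k) = ω(k)² ∫∫ δ(ω(k) + ω(k₁) - ω(k') - ω(k + k₁ - k')) dk₁ dk'`, with values in `[0, ∞]`. -/
def collisionRate (k : ℝ) : ℝ≥0∞ :=
  ENNReal.ofReal (omega k ^ 2) *
    ∫⁻ k' in Ioc (-(1 / 2) : ℝ) (1 / 2),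
      deltaIntegral (fun k₁ => energyDefect k k₁ k') (nontrivialPartners k k')

/-- The collision frequency `V(k)` as a real number. -/
def V (k : ℝ) : ℝ := (collisionRate k).toReal

/-- `V(k) / (ε^{8/5} p + V(k) + i ε ω'(k) ξ) - 1`. -/
def defect (ε p ξ k : ℝ) : ℂ :=
  (V k : ℂ) / (((ε ^ (8 / 5 : ℝ) * p + V k : ℝ) : ℂ)
    + Complex.I * ((ε * deriv omega k * ξ : ℝ) : ℂ)) - 1

/-- `a₁^ε(p, ξ)`. -/
def a₁ (ε : ℝ) (x : ℝ × ℝ) : ℂ :=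
  ((ε ^ (-(8 / 5) : ℝ) : ℝ) : ℂ) *
    ∫ k in (-(1 / 2) : ℝ)..(1 / 2), defect ε x.1 x.2 k * ((V k : ℝ) : ℂ)

/-- `a₂^ε(p, ξ)`. -/
def a₂ (ε : ℝ) (x : ℝ × ℝ) : ℂ :=
  ((ε ^ (-(8 / 5) : ℝ) : ℝ) : ℂ) *
    ∫ k in (-(1 / 2) : ℝ)..(1 / 2),
      defect ε x.1 x.2 k * ((ε ^ (3 / 5 : ℝ) * V k / omega k : ℝ) : ℂ)

/-- `a₃^ε(p, ξ)`. -/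
def a₃ (ε : ℝ) (x : ℝ × ℝ) : ℂ :=
  ((ε⁻¹ : ℝ) : ℂ) *
    ∫ k in (-(1 / 2) : ℝ)..(1 / 2),
      defect ε x.1 x.2 k * ((ε ^ (3 / 5 : ℝ) * V k / omega k ^ 2 : ℝ) : ℂ)

def kappa₁ (v₀ : ℝ) : ℝ :=
  6 / 5 * (π / v₀) ^ (3 / 5 : ℝ) * ∫ z in Ioi (0 : ℝ), z ^ (3 / 5 : ℝ) / (z ^ 2 + 1)

def kappa₂ : ℝ := 6 / 5 * ∫ z in Ioi (0 : ℝ), 1 / (z ^ 2 + 1)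

def kappa₃ (v₀ : ℝ) : ℝ :=
  6 / 5 * (v₀ / π) ^ (3 / 5 : ℝ) * ∫ z in Ioi (0 : ℝ), z ^ (-(3 / 5) : ℝ) / (z ^ 2 + 1)

/-- The open domain `(0, ∞) × ℝ` of the variables `(p, ξ)`. -/
def domain : Set (ℝ × ℝ) := Ioi 0 ×ˢ univ

/-- `a^ε → l` pointwise on `(0, ∞) × ℝ` as `ε → 0⁺`. -/
def TendstoPointwise (a : ℝ → ℝ × ℝ → ℂ) (l : ℝ × ℝ → ℝ) : Prop :=
  ∀ x ∈ domain, Tendsto (fun ε => a ε x) (𝓝[>] 0) (𝓝 (l x : ℂ))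

/-- `a^ε → l` strongly in `L^q_loc((0, ∞) × ℝ)` as `ε → 0⁺`. -/
def TendstoLocLq (q : ℝ≥0∞) (a : ℝ → ℝ × ℝ → ℂ) (l : ℝ × ℝ → ℝ) : Prop :=
  ∀ K : Set (ℝ × ℝ), IsCompact K → K ⊆ domain →
    (∀ ε > 0, MemLp (a ε) q (volume.restrict K)) ∧
    MemLp (fun x => (l x : ℂ)) q (volume.restrict K) ∧
    Tendsto (fun ε => eLpNorm (fun x => a ε x - (l x : ℂ)) q (volume.restrict K))
      (𝓝[>] 0) (𝓝 0)

/-- `a^ε ∈ L^∞_loc((0, ∞) × ℝ)`, uniformly with respect to `ε > 0`. -/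
def UniformlyLocBounded (a : ℝ → ℝ × ℝ → ℂ) : Prop :=
  ∀ K : Set (ℝ × ℝ), IsCompact K → K ⊆ domain → ∃ C : ℝ, ∀ ε > 0,
    MemLp (a ε) ∞ (volume.restrict K) ∧
    eLpNorm (a ε) ∞ (volume.restrict K) ≤ ENNReal.ofReal C

end PhononSymbol

end

/-! Put x = πk, a = πk₁, y = πk', with all three brought into [0, π] by periodicity. If x + a − y
stays in [0, π], the energy defect factors and vanishes only for trivial collisions. Outside that
range it is a sinusoid in a with exactly one admissible zero, where the derivative in k₁ has modulus
π√((cos x + cos y)² + 4 sin x sin y). Hence the inner delta integral has one term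
(`deltaIntegral_energyDefect`) and V is an explicit one-dimensional integral.

In the half-angle variables τ = tan(x/2), σ = tan((π − y)/2) the two terms of the radicand are
comparable to (σ² − τ²)² and τσ when both variables are small, and these balance at σ ~ τ^{1/3}.
Taking τ = s³ and σ = st therefore gives a regular limit as s → 0: V = ω^{5/3} times `rateProfile
s`, a profile bounded above and away from 0, with limit `rateProfile 0` = v₀.

Since D(−k) is the conjugate of D(k), the symbols are real, and −Re D splits into a damping term
carrying A = ε^{8/5}p and a transport term carrying B = εω'ξ. Damping yields the −p of a₁ and is
O(ε^{j/15}) for the weights V/ω^j with j = 1, 2 (`exists_dampingPart_le`). Transport lives where V ~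
k^{5/3} balances B ~ ε, that is at k ~ ε^{3/5}, where A is negligible. Dominated convergence in z =
ε^{-3/5}k gives its limit (`tendsto_transportPart`), and a power substitution extracts |ξ| and the
κ's (`integral_transportLimit`). The same bounds are uniform on compact sets, which upgrades
pointwise to L^q_loc convergence. -/

noncomputable section

namespace PhononSymbol

/-! ### Trigonometry of the resonance manifold -/

/-- The Jacobian of the energy defect on the nontrivial resonance manifold, up to the factor `π`. -/
def resonanceJacobian (x y : ℝ) : ℝ := √((cos x + cos y) ^ 2 + 4 * (sin x * sin y))

theorem resonanceJacobian_pi_sub (x y : ℝ) :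
    resonanceJacobian (π - x) (π - y) = resonanceJacobian x y := by
  simp only [resonanceJacobian, cos_pi_sub, sin_pi_sub]
  congr 1; ring

/-- The last two factors vanish at the trivial collisions y = a and y = x. This rules out other
zeros as long as x + a − y lies in [0, π], where the absolute value in ω plays no role. -/
theorem sin_add_sin_sub_sin_sub_sin (x a y : ℝ) :
    sin x + sin a - sin y - sin (x + a - y) =
      4 * sin ((x + a) / 2) * sin ((y - a) / 2) * sin ((y - x) / 2) := by
  obtain ⟨X, rfl⟩ : ∃ X, x = 2 * X := ⟨x / 2, by ring⟩
  obtain ⟨A, rfl⟩ : ∃ A, a = 2 * A := ⟨a / 2, by ring⟩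
  obtain ⟨Y, rfl⟩ : ∃ Y, y = 2 * Y := ⟨y / 2, by ring⟩
  have e1 : 2 * X + 2 * A - 2 * Y = 2 * (X + A - Y) := by ring
  have e2 : (2 * X + 2 * A) / 2 = X + A := by ring
  have e3 : (2 * Y - 2 * A) / 2 = Y - A := by ring
  have e4 : (2 * Y - 2 * X) / 2 = Y - X := by ring
  rw [e1, e2, e3, e4]
  simp only [sin_two_mul, sin_add, sin_sub, cos_add, cos_sub]
  have hX := sin_sq_add_cos_sq X
  have hA := sin_sq_add_cos_sq A
  have hY := sin_sq_add_cos_sq Y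
  have hX' : cos X ^ 2 = 1 - sin X ^ 2 := by linarith
  have hA' : cos A ^ 2 = 1 - sin A ^ 2 := by linarith
  have hY' : cos Y ^ 2 = 1 - sin Y ^ 2 := by linarith
  ring_nf
  simp only [hX', hA', hY']
  ring

/-- The unique nontrivial partner in a collision with `k < k'`. -/
theorem exists_resonant_partner_of_lt {x y : ℝ} (hx : 0 < x) (hxy : x < y) (hy : y < π) :
    ∃ a₀ ∈ Ioo 0 π, a₀ ≠ y ∧ sin (x + a₀ - y) < 0 ∧
      |cos a₀ + cos (x + a₀ - y)| = resonanceJacobian x y ∧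
      sin x + sin a₀ - sin y - |sin (x + a₀ - y)| = 0 ∧
      ∀ a ∈ Icc 0 π, a ≠ y → sin x + sin a - sin y - |sin (x + a - y)| = 0 → a = a₀ := by
  obtain ⟨d, hd⟩ : ∃ d, d = (y - x) / 2 := ⟨_, rfl⟩
  obtain ⟨m, hm⟩ : ∃ m, m = (x + y) / 2 := ⟨_, rfl⟩
  have hx' : x = m - d := by rw [hd, hm]; ring
  have hy' : y = m + d := by rw [hd, hm]; ring
  have hd0 : 0 < d := by linarith
  have hd1 : d < π / 2 := by linarith
  have hcd : 0 < cos d := cos_pos_of_mem_Ioo ⟨by linarith, hd1⟩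
  have hsd : 0 < sin d := sin_pos_of_pos_of_lt_pi hd0 (by linarith)
  have hm1 : cos m < cos d := cos_lt_cos_of_nonneg_of_le_pi hd0.le (by linarith) (by linarith)
  have hm2 : -cos d < cos m := by
    rw [← cos_pi_sub]
    exact cos_lt_cos_of_nonneg_of_le_pi (by linarith) (by linarith) (by linarith)
  -- Once x + a − y < 0, the defect is 2 cos d (sin(a − d) − r), so the partner is a = d + arcsin r.
  -- The bounds |r| < sin d put arcsin r in (−d, d), which makes the partner admissible.
  set r := sin d * cos m / cos d with hr
  have hr1 : r < sin d := by rw [hr, div_lt_iff₀ hcd]; exact mul_lt_mul_of_pos_left hm1 hsd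
  have hr2 : -sin d < r := by rw [hr, lt_div_iff₀ hcd]; nlinarith
  have hd2 := sin_le_one d
  set b := arcsin r with hb
  have hsb : sin b = r := sin_arcsin (by linarith) (by linarith)
  have hbd : b < d := by
    rw [← arcsin_sin (x := d) (by linarith) hd1.le]
    exact strictMonoOn_arcsin ⟨by linarith, by linarith⟩ ⟨by linarith, by linarith⟩ hr1
  have hbd' : -d < b := by
    rw [← arcsin_sin (x := -d) (by linarith) (by linarith), sin_neg]
    exact strictMonoOn_arcsin ⟨by linarith, by linarith⟩ ⟨by linarith, by linarith⟩ hr2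
  have key : ∀ a, sin x + sin a - sin y + sin (x + a - y) =
      2 * cos d * (sin (a - d) - r) := by
    intro a
    obtain ⟨c, rfl⟩ : ∃ c, a = c + d := ⟨a - d, by ring⟩
    have e1 : m - d + (c + d) - (m + d) = c - d := by ring
    have e2 : 2 * cos d * (sin (c + d - d) - r) = 2 * cos d * sin c - 2 * sin d * cos m := by
      rw [hr]; field_simp; ring_nf
    rw [hx', hy', e1, e2, sin_sub, sin_add, sin_add, sin_sub]
    ring
  have hs0 : x + (d + b) - y = b - d := by rw [hx', hy']; ring
  have hsneg : sin (b - d) < 0 := sin_neg_of_neg_of_neg_pi_lt (by linarith) (by linarith)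
  refine ⟨d + b, ⟨by linarith, by linarith⟩, by linarith, by rwa [hs0], ?_, ?_, ?_⟩
  -- The two cosines add up to 2 cos b cos d; eliminating b through sin b = r turns its square into
  -- the radicand of the Jacobian.
  · rw [hs0, add_comm d b, cos_add, cos_sub]
    have hcb : cos b = √(1 - r ^ 2) := cos_arcsin r
    have h1 : 0 ≤ cos b := cos_arcsin_nonneg r
    have e : cos b * cos d - sin b * sin d + (cos b * cos d + sin b * sin d)
      = 2 * cos b * cos d := by ring
    rw [e, abs_of_nonneg (by positivity), resonanceJacobian]
    symm
    rw [sqrt_eq_iff_mul_self_eq_of_pos (by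
      have : 0 < cos b := cos_pos_of_mem_Ioo ⟨by linarith, by linarith⟩
      positivity)]
    have hcb2 : cos b ^ 2 = 1 - r ^ 2 := by rw [← hsb, ← cos_sq']
    have hr' : r * cos d = sin d * cos m := by rw [hr]; field_simp
    have : 2 * cos b * cos d * (2 * cos b * cos d) =
        4 * cos d ^ 2 - 4 * (sin d * cos m) ^ 2 := by
      rw [← hr']
      linear_combination (4 * cos d ^ 2) * hcb2
    rw [this, hx', hy']
    simp only [sin_add, cos_add, sin_sub, cos_sub]
    have hd' : cos d ^ 2 = 1 - sin d ^ 2 := cos_sq' d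
    have hm' : sin m ^ 2 = 1 - cos m ^ 2 := sin_sq m
    ring_nf
    simp only [hd', hm']
    ring
  · rw [hs0, abs_of_neg hsneg]
    have := key (d + b)
    rw [hs0, add_sub_cancel_left, hsb, sub_self, mul_zero] at this
    linarith
  · intro a ha hay h
    rcases le_or_gt 0 (x + a - y) with hs | hs
    · exfalso
      rw [abs_of_nonneg (sin_nonneg_of_nonneg_of_le_pi hs (by linarith [ha.2])),
        sin_add_sin_sub_sin_sub_sin] at h
      have h1 : sin ((x + a) / 2) ≠ 0 :=
        (sin_pos_of_pos_of_lt_pi (by linarith [ha.1]) (by linarith [ha.2])).ne'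
      have h2 : sin ((y - x) / 2) ≠ 0 :=
        (sin_pos_of_pos_of_lt_pi (by linarith) (by linarith)).ne'
      have h3 : sin ((y - a) / 2) = 0 := by simpa [h1, h2] using h
      rw [sin_eq_zero_iff_of_lt_of_lt (by linarith [ha.2]) (by linarith [ha.1])] at h3
      exact hay (by linarith)
    · rw [abs_of_neg (sin_neg_of_neg_of_neg_pi_lt hs (by linarith [ha.1]))] at h
      have h1 := key a
      have h2 : sin (a - d) = r := by
        have : 2 * cos d * (sin (a - d) - r) = 0 := by rw [← h1]; linarith
        have := (mul_eq_zero.1 this).resolve_left (by positivity)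
        linarith
      have h3 : b = a - d := by
        rw [hb, ← h2, arcsin_sin] <;> linarith [ha.1]
      linarith

/-- The unique nontrivial partner in a collision with `k ≠ k'`. -/
theorem exists_resonant_partner {x y : ℝ} (hx : x ∈ Ioo 0 π) (hy : y ∈ Ioo 0 π) (hxy : x ≠ y) :
    ∃ a₀ ∈ Ioo 0 π, a₀ ≠ y ∧ sin (x + a₀ - y) < 0 ∧
      |cos a₀ + cos (x + a₀ - y)| = resonanceJacobian x y ∧
      sin x + sin a₀ - sin y - |sin (x + a₀ - y)| = 0 ∧
      ∀ a ∈ Icc 0 π, a ≠ y → sin x + sin a - sin y - |sin (x + a - y)| = 0 → a = a₀ := by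
  rcases lt_or_gt_of_ne hxy with h | h
  · exact exists_resonant_partner_of_lt hx.1 h hy.2
  -- The reflection θ ↦ π − θ of all phases preserves sines and the Jacobian and exchanges x > y
  -- with x < y.
  · obtain ⟨a, ha, h1, h2, h3, h4, h5⟩ := exists_resonant_partner_of_lt
      (x := π - x) (y := π - y) (by linarith [hx.2]) (by linarith) (by linarith [hy.1])
    have e : ∀ a, x + (π - a) - y = π - (π - x + a - (π - y)) := fun a => by ring
    refine ⟨π - a, ⟨by linarith [ha.2], by linarith [ha.1]⟩, fun h => h1 (by linarith), ?_, ?_, ?_,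
      ?_⟩
    · rw [e, sin_pi_sub]; exact h2
    · rw [e, cos_pi_sub, cos_pi_sub, ← resonanceJacobian_pi_sub, ← h3, ← abs_neg]; ring_nf
    · rw [e, sin_pi_sub, sin_pi_sub]; simpa [sin_pi_sub] using h4
    · intro a' ha' hay' h'
      have := h5 (π - a') ⟨by linarith [ha'.2], by linarith [ha'.1]⟩ (fun h => hay' (by linarith))
        (by
          have e' : π - x + (π - a') - (π - y) = π - (x + a' - y) := by ring
          rw [e', sin_pi_sub, sin_pi_sub, sin_pi_sub, sin_pi_sub]; exact h')
      linarith

/-! ### Periodicity and the collision rate as a single integral -/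

theorem omega_add_int (k : ℝ) (n : ℤ) : omega (k + n) = omega k := by
  rw [omega, omega, mul_add, mul_comm π (n : ℝ), abs_eq_abs.2 ?_]
  rw [sin_add_int_mul_pi]
  rcases Int.even_or_odd n with h | h
  · left; simp [h.neg_one_zpow]
  · right; simp [h.neg_one_zpow]

theorem omega_sub_int (k : ℝ) (n : ℤ) : omega (k - n) = omega k := by
  have := omega_add_int k (-n); push_cast at this; exact this

theorem omega_neg (k : ℝ) : omega (-k) = omega k := by simp [omega]

theorem omega_of_mem {k : ℝ} (hk : k ∈ Icc (0 : ℝ) 1) : omega k = sin (π * k) :=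
  abs_of_nonneg (sin_nonneg_of_nonneg_of_le_pi (mul_nonneg pi_pos.le hk.1)
    (by nlinarith [pi_pos, hk.2]))

theorem hasDerivAt_omega_of_pos {k : ℝ} (h : 0 < sin (π * k)) :
    HasDerivAt omega (π * cos (π * k)) k := by
  have h1 : HasDerivAt (fun k => sin (π * k)) (cos (π * k) * (π * 1)) k :=
    ((hasDerivAt_id k).const_mul π).sin
  have h2 : HasDerivAt omega _ k := (hasDerivAt_abs_pos h).comp k h1
  exact h2.congr_deriv (by ring)

theorem hasDerivAt_omega_of_neg {k : ℝ} (h : sin (π * k) < 0) :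
    HasDerivAt omega (-(π * cos (π * k))) k := by
  have h1 : HasDerivAt (fun k => sin (π * k)) (cos (π * k) * (π * 1)) k :=
    ((hasDerivAt_id k).const_mul π).sin
  have h2 : HasDerivAt omega _ k := (hasDerivAt_abs_neg h).comp k h1
  exact h2.congr_deriv (by ring)

theorem energyDefect_sub_int (k z k' : ℝ) (n : ℤ) :
    energyDefect k (z - n) k' = energyDefect k z k' := by
  have : k + (z - n) - k' = k + z - k' - n := by ring
  rw [energyDefect, energyDefect, this, omega_sub_int, omega_sub_int]

theorem eq_zero_of_abs_lt_one {r : ℝ} (n : ℤ) (h : r = n) (h1 : -1 < r) (h2 : r < 1) : r = 0 := by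
  rw [h] at h1 h2 ⊢
  have h1' : -1 < n := by exact_mod_cast h1
  have h2' : n < 1 := by exact_mod_cast h2
  have : n = 0 := by omega
  simp [this]

/-- The sum over zeros has exactly one term. The partner w is found in (0, 1), where ω is a plain
sine, and is then shifted by an integer n into the window (−1/2, 1/2]. -/
theorem deltaIntegral_energyDefect {k k' : ℝ} (hk : k ∈ Ioo (0 : ℝ) 1) (hk' : k' ∈ Ioo (0 : ℝ) 1)
    (hne : k ≠ k') :
    deltaIntegral (fun k₁ => energyDefect k k₁ k') (nontrivialPartners k k') =
      (ENNReal.ofReal (π * resonanceJacobian (π * k) (π * k')))⁻¹ := by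
  have hpi := pi_pos
  have hmem : ∀ {k : ℝ}, k ∈ Ioo (0 : ℝ) 1 → π * k ∈ Ioo 0 π := fun hk =>
    ⟨mul_pos hpi hk.1, by nlinarith [hk.2]⟩
  obtain ⟨a, ha, hay, hs, hj, hz, hu⟩ := exists_resonant_partner (hmem hk) (hmem hk')
    (fun h => hne (mul_left_cancel₀ hpi.ne' h))
  obtain ⟨w, rfl⟩ : ∃ w, a = π * w := ⟨a / π, by field_simp⟩
  have hw : w ∈ Ioo (0 : ℝ) 1 :=
    ⟨pos_of_mul_pos_right ha.1 hpi.le, by nlinarith [ha.2]⟩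
  have hdef : ∀ z ∈ Icc (0 : ℝ) 1, energyDefect k z k' = sin (π * k) + sin (π * z) - sin (π * k')
      - |sin (π * k + π * z - π * k')| := by
    intro z hz
    rw [energyDefect, omega_of_mem (Ioo_subset_Icc_self hk), omega_of_mem hz,
      omega_of_mem (Ioo_subset_Icc_self hk'), omega, mul_sub, mul_add]
  obtain ⟨n, hn⟩ : ∃ n : ℤ, w - n ∈ Ioc (-(1 / 2) : ℝ) (1 / 2) := by
    rcases le_or_gt w (1 / 2) with h | h
    · exact ⟨0, by push_cast; constructor <;> linarith [hw.1]⟩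
    · exact ⟨1, by push_cast; constructor <;> linarith [hw.2]⟩
  have hz0 : w - n ∈ nontrivialPartners k k' ∧ energyDefect k (w - n) k' = 0 := by
    refine ⟨⟨hn, fun j hj => ?_, fun j hj => ?_⟩, ?_⟩
    · have := eq_zero_of_abs_lt_one j hj (by linarith [hk.2, hk'.1]) (by linarith [hk.1, hk'.2])
      exact hne (by linarith)
    · refine hay ?_
      have : k' - w = ((j - n : ℤ) : ℝ) := by push_cast; linarith
      have := eq_zero_of_abs_lt_one _ this (by linarith [hw.2, hk'.1]) (by linarith [hw.1, hk'.2])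
      rw [show w = k' by linarith]
    · rw [energyDefect_sub_int, hdef w (Ioo_subset_Icc_self hw), hz]
  have huniq : ∀ z, z ∈ nontrivialPartners k k' ∧ energyDefect k z k' = 0 → z = w - n := by
    rintro z ⟨⟨hz1, -, hz3⟩, hz4⟩
    have hf : Int.fract z ∈ Icc (0 : ℝ) 1 := ⟨Int.fract_nonneg z, (Int.fract_lt_one z).le⟩
    have h0 : energyDefect k (Int.fract z) k' = 0 := by
      rw [Int.fract, energyDefect_sub_int, hz4]
    rw [hdef _ hf] at h0
    have h1 := hu (π * Int.fract z) ⟨mul_nonneg hpi.le hf.1, by nlinarith [hf.2]⟩ (fun h => by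
      have h2 : Int.fract z = k' := mul_left_cancel₀ hpi.ne' h
      refine hz3 (-⌊z⌋) ?_
      rw [← h2, Int.fract]; push_cast; ring) h0
    have h2 : Int.fract z = w := mul_left_cancel₀ hpi.ne' h1
    have h3 : z - (w - n) = ((⌊z⌋ + n : ℤ) : ℝ) := by
      rw [← h2, Int.fract]; push_cast; ring
    linarith [eq_zero_of_abs_lt_one _ h3 (by linarith [hz1.1, hn.2]) (by linarith [hz1.2, hn.1])]
  have hderiv : HasDerivAt (fun z => energyDefect k z k')
      (π * (cos (π * w) + cos (π * k + π * w - π * k'))) (w - n) := by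
    have h1 : HasDerivAt omega (π * cos (π * w)) w := hasDerivAt_omega_of_pos
      (sin_pos_of_mem_Ioo ha)
    have h2 : HasDerivAt omega (-(π * cos (π * (k + w - k')))) (k + w - k') :=
      hasDerivAt_omega_of_neg (by rw [mul_sub, mul_add]; exact hs)
    have h3 : HasDerivAt (fun z => k + z - k') 1 w :=
      ((hasDerivAt_id w).const_add k).sub_const k'
    have h4 : HasDerivAt (omega ∘ fun z => k + z - k') (-(π * cos (π * (k + w - k'))) * 1) w :=
      HasDerivAt.comp w h2 h3
    have h4 : HasDerivAt (fun z => energyDefect k z k')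
        (π * cos (π * w) - (-(π * cos (π * (k + w - k'))) * 1)) w :=
      ((h1.const_add (omega k)).sub_const (omega k')).sub h4
    -- By periodicity the derivative at the shifted point w − n is the one computed at w.
    have h5 : (fun z => energyDefect k z k') = fun z => energyDefect k (z + n) k' := by
      funext z
      have := energyDefect_sub_int k (z + n) k' n
      rw [add_sub_cancel_right] at this
      exact this
    rw [h5]
    have h6 : HasDerivAt (fun z => energyDefect k z k')
        (π * cos (π * w) - (-(π * cos (π * (k + w - k'))) * 1)) (w - n + n) := by
      rwa [sub_add_cancel]
    refine (h6.comp_add_const (w - n) n).congr_deriv ?_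
    rw [mul_sub, mul_add]; ring
  rw [deltaIntegral, tsum_eq_single (⟨w - n, hz0⟩ : {z : ℝ // z ∈ nontrivialPartners k k' ∧
    energyDefect k z k' = 0})]
  · rw [hderiv.deriv, abs_mul, hj, abs_of_pos hpi]
  · rintro ⟨z, hz⟩ h
    exact absurd (Subtype.ext (huniq z hz)) h

theorem deltaIntegral_sub_int (k k' : ℝ) (n : ℤ) :
    deltaIntegral (fun k₁ => energyDefect k k₁ (k' - n)) (nontrivialPartners k (k' - n)) =
      deltaIntegral (fun k₁ => energyDefect k k₁ k') (nontrivialPartners k k') := by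
  have h1 : (fun k₁ => energyDefect k k₁ (k' - n)) = fun k₁ => energyDefect k k₁ k' := by
    funext z
    have : k + z - (k' - n) = k + z - k' + n := by ring
    rw [energyDefect, energyDefect, this, omega_sub_int, omega_add_int]
  have h2 : nontrivialPartners k (k' - n) = nontrivialPartners k k' := by
    have : ∀ a : ℝ, (∀ m : ℤ, k' - n - a ≠ m) ↔ ∀ m : ℤ, k' - a ≠ m := fun a =>
      ⟨fun h m hm => h (m - n) (by push_cast; linarith),
        fun h m hm => h (m + n) (by push_cast; linarith)⟩
    ext z
    simp only [nontrivialPartners, mem_ofPred_eq, this]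
  rw [h1, h2]

theorem collisionRate_sub_int (k : ℝ) (n : ℤ) : collisionRate (k - n) = collisionRate k := by
  have h1 : ∀ k', (fun k₁ => energyDefect (k - n) k₁ k') = fun k₁ => energyDefect k k₁ k' := by
    intro k'
    funext z
    have : k - n + z - k' = k + z - k' - n := by ring
    rw [energyDefect, energyDefect, this, omega_sub_int, omega_sub_int]
  have h2 : ∀ k', nontrivialPartners (k - n) k' = nontrivialPartners k k' := by
    intro k'
    have : (∀ m : ℤ, k' - (k - n) ≠ m) ↔ ∀ m : ℤ, k' - k ≠ m :=
      ⟨fun h m hm => h (m + n) (by push_cast; linarith),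
        fun h m hm => h (m - n) (by push_cast; linarith)⟩
    ext z
    simp only [nontrivialPartners, mem_ofPred_eq, this]
  simp only [collisionRate, omega_sub_int, h1, h2]

theorem setLIntegral_Ioc_eq_of_periodic (f : ℝ → ℝ≥0∞) (hf : ∀ x (n : ℤ), f (x - n) = f x) :
    ∫⁻ x in Ioc (-(1 / 2) : ℝ) (1 / 2), f x = ∫⁻ x in Ioc (0 : ℝ) 1, f x := by
  have h1 := isAddFundamentalDomain_Ioc (T := (1 : ℝ)) one_pos (-(1 / 2)) volume
  have h2 := isAddFundamentalDomain_Ioc (T := (1 : ℝ)) one_pos 0 volume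
  have e1 : Ioc (-(1 / 2) : ℝ) (1 / 2) = Ioc (-(1 / 2) : ℝ) (-(1 / 2) + 1) := by norm_num
  have e2 : Ioc (0 : ℝ) 1 = Ioc (0 : ℝ) (0 + 1) := by norm_num
  rw [e1, e2]
  refine h1.setLIntegral_eq h2 f ?_
  rintro ⟨_, ⟨n, rfl⟩⟩ x
  have := hf x (-n)
  push_cast at this
  rw [← this]
  congr 1
  simp [AddSubgroup.vadd_def, add_comm]

/-- Periodicity in k' moves the window to (0, 1), where the single-term formula holds off the null
set k' = k. -/
theorem collisionRate_eq_lintegral {k : ℝ} (hk : k ∈ Ioo (0 : ℝ) 1) :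
    collisionRate k = ENNReal.ofReal (sin (π * k) ^ 2) *
      ∫⁻ k' in Ioo (0 : ℝ) 1, (ENNReal.ofReal (π * resonanceJacobian (π * k) (π * k')))⁻¹ := by
  rw [collisionRate, omega_of_mem (Ioo_subset_Icc_self hk), setLIntegral_Ioc_eq_of_periodic _
    (fun x n => deltaIntegral_sub_int k x n), setLIntegral_congr Ioo_ae_eq_Ioc.symm]
  congr 1
  refine setLIntegral_congr_fun_ae measurableSet_Ioo ?_
  have : ∀ᵐ x : ℝ, x ≠ k := by simp [ae_iff, measure_singleton]
  filter_upwards [this] with x hx hx'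
  exact deltaIntegral_energyDefect hk hx' hx.symm

/-- Modulo 1, −k is 1 − k, and the reflection k' ↦ 1 − k' preserves the Jacobian. -/
theorem collisionRate_neg_of_mem {k : ℝ} (hk : k ∈ Ioo (0 : ℝ) 1) :
    collisionRate (-k) = collisionRate k := by
  have h1 : collisionRate (-k) = collisionRate (1 - k) := by
    rw [← collisionRate_sub_int (1 - k) 1]; congr 1; push_cast; ring
  have hk1 : 1 - k ∈ Ioo (0 : ℝ) 1 := ⟨by linarith [hk.2], by linarith [hk.1]⟩
  have e : ∀ z, π * (1 - z) = π - π * z := fun z => by ring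
  rw [h1, collisionRate_eq_lintegral hk1, collisionRate_eq_lintegral hk, e, sin_pi_sub]
  congr 1
  rw [← lintegral_indicator measurableSet_Ioo, ← lintegral_indicator measurableSet_Ioo,
    ← lintegral_sub_left_eq_self _ (1 : ℝ)]
  congr 1
  funext z
  have : (1 - z ∈ Ioo (0 : ℝ) 1) ↔ z ∈ Ioo (0 : ℝ) 1 :=
    ⟨fun h => ⟨by linarith [h.2], by linarith [h.1]⟩, fun h => ⟨by linarith [h.2], by linarith [h.1]⟩⟩
  simp only [indicator, this, e, resonanceJacobian_pi_sub]

/-! ### The rescaled collision integral and its limit -/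

/-- The function equal to `t ^ a` on `(0, 1]` and to `t ^ b` on `(1, ∞)`. -/
def powerEnvelope (a b t : ℝ) : ℝ := if t ≤ 1 then t ^ a else t ^ b

theorem powerEnvelope_of_le {a b t : ℝ} (h : t ≤ 1) : powerEnvelope a b t = t ^ a := if_pos h

theorem powerEnvelope_of_lt {a b t : ℝ} (h : 1 < t) : powerEnvelope a b t = t ^ b :=
  if_neg h.not_ge

theorem integrableOn_powerEnvelope {a b : ℝ} (ha : -1 < a) (hb : b < -1) :
    IntegrableOn (powerEnvelope a b) (Ioi 0) := by
  rw [← Ioc_union_Ioi_eq_Ioi zero_le_one]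
  refine IntegrableOn.union ?_ ?_
  · refine IntegrableOn.congr_fun (f := fun t => t ^ a) ?_ (fun t ht =>
      (powerEnvelope_of_le ht.2).symm) measurableSet_Ioc
    exact (intervalIntegrable_iff_integrableOn_Ioc_of_le zero_le_one).1
      (intervalIntegral.intervalIntegrable_rpow' ha)
  · exact (integrableOn_Ioi_rpow_of_lt hb one_pos).congr_fun (fun t ht =>
      (powerEnvelope_of_lt ht).symm) measurableSet_Ioi

/-- The radicand of the collision integral in the variable `t = s⁻¹ tan ((π - π k') / 2)`, where
`s ^ 3 = tan (π k / 2)`. -/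
def rescaledRadicand (s t : ℝ) : ℝ :=
  (t ^ 2 - s ^ 4) ^ 2 + 4 * t * (1 + s ^ 6) * (1 + s ^ 2 * t ^ 2)

theorem four_mul_le_rescaledRadicand (s : ℝ) {t : ℝ} (ht : 0 < t) :
    4 * t ≤ rescaledRadicand s t := by
  have h : rescaledRadicand s t - 4 * t =
      (t ^ 2 - s ^ 4) ^ 2 + 4 * t * (s ^ 6 + s ^ 2 * t ^ 2 + s ^ 8 * t ^ 2) := by
    rw [rescaledRadicand]; ring
  have : 0 ≤ rescaledRadicand s t - 4 * t := by rw [h]; positivity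
  linarith

theorem rescaledRadicand_pos (s : ℝ) {t : ℝ} (ht : 0 < t) : 0 < rescaledRadicand s t := by
  linarith [four_mul_le_rescaledRadicand s ht]

/-- A majorant independent of s, integrable at both ends: the linear term 4t controls small t, and
(t² − s⁴)² controls large t. -/
theorem inv_sqrt_rescaledRadicand_le {s t : ℝ} (hs : s ∈ Icc (0 : ℝ) 1) (ht : 0 < t) :
    (√(rescaledRadicand s t))⁻¹ ≤ 2 * powerEnvelope (-(1 / 2)) (-2) t := by
  have h4 := four_mul_le_rescaledRadicand s ht
  rcases le_or_gt t 1 with h | h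
  · rw [powerEnvelope_of_le h, rpow_neg ht.le, ← sqrt_eq_rpow]
    have h1 : (√(rescaledRadicand s t))⁻¹ ≤ (√t)⁻¹ :=
      inv_anti₀ (sqrt_pos.2 ht) (sqrt_le_sqrt (by linarith))
    have : 0 ≤ (√t)⁻¹ := by positivity
    linarith
  · rw [powerEnvelope_of_lt h, rpow_neg ht.le, rpow_two]
    have h1 : (t ^ 2 / 2) ^ 2 ≤ rescaledRadicand s t := by
      -- For t ≤ 2 the difference t² − s⁴ may be small, but t⁴/4 ≤ 2t is covered by the linear term;
      -- for t > 2, s⁴ ≤ 1 ≤ t²/2.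
      rcases le_or_gt t 2 with h2 | h2
      · have h3 : t ^ 3 ≤ 8 := by
          calc t ^ 3 ≤ 2 ^ 3 := by gcongr
            _ = 8 := by norm_num
        nlinarith
      · have hs4 : s ^ 4 ≤ 1 := pow_le_one₀ hs.1 hs.2
        have h5 : t ^ 2 / 2 ≤ t ^ 2 - s ^ 4 := by nlinarith
        have h6 : (t ^ 2 / 2) ^ 2 ≤ (t ^ 2 - s ^ 4) ^ 2 := by gcongr
        have h7 : 0 ≤ 4 * t * (1 + s ^ 6) * (1 + s ^ 2 * t ^ 2) := by positivity
        rw [rescaledRadicand]; linarith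
    have h2 : t ^ 2 / 2 ≤ √(rescaledRadicand s t) := le_sqrt_of_sq_le h1
    calc (√(rescaledRadicand s t))⁻¹ ≤ (t ^ 2 / 2)⁻¹ := inv_anti₀ (by positivity) h2
      _ = 2 * (t ^ 2)⁻¹ := by rw [inv_div, div_eq_mul_inv]

theorem measurable_rescaledRadicand :
    Measurable fun p : ℝ × ℝ => (√(rescaledRadicand p.1 p.2))⁻¹ := by
  unfold rescaledRadicand; fun_prop

theorem integrableOn_inv_sqrt_rescaledRadicand {s : ℝ} (hs : s ∈ Icc (0 : ℝ) 1) :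
    IntegrableOn (fun t => (√(rescaledRadicand s t))⁻¹) (Ioi 0) := by
  refine Integrable.mono' ((integrableOn_powerEnvelope (a := -(1 / 2)) (b := -2)
    (by norm_num) (by norm_num)).const_mul 2)
    (measurable_rescaledRadicand.comp measurable_prodMk_left).aestronglyMeasurable ?_
  filter_upwards [ae_restrict_mem measurableSet_Ioi] with t ht
  rw [norm_of_nonneg (by positivity)]
  exact inv_sqrt_rescaledRadicand_le hs ht

/-- The collision integral after rescaling. -/
def rescaledIntegral (s : ℝ) : ℝ := ∫ t in Ioi (0 : ℝ), (√(rescaledRadicand s t))⁻¹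

theorem measurable_rescaledIntegral : Measurable rescaledIntegral :=
  (measurable_rescaledRadicand.stronglyMeasurable.integral_prod_right
    (ν := volume.restrict (Ioi (0 : ℝ)))).measurable

theorem rescaledIntegral_le {s : ℝ} (hs : s ∈ Icc (0 : ℝ) 1) :
    rescaledIntegral s ≤ ∫ t in Ioi (0 : ℝ), 2 * powerEnvelope (-(1 / 2)) (-2) t :=
  setIntegral_mono_on (integrableOn_inv_sqrt_rescaledRadicand hs)
    ((integrableOn_powerEnvelope (by norm_num) (by norm_num)).const_mul 2) measurableSet_Ioi
    fun _ ht => inv_sqrt_rescaledRadicand_le hs ht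

theorem one_fifth_le_rescaledIntegral {s : ℝ} (hs : s ∈ Icc (0 : ℝ) 1) :
    1 / 5 ≤ rescaledIntegral s := by
  have h1 : ∀ t ∈ Ioc (0 : ℝ) 1, 1 / 5 ≤ (√(rescaledRadicand s t))⁻¹ := by
    intro t ht
    -- On the unit square the radicand is at most 1 + 16, below 25.
    have h2 : √(rescaledRadicand s t) ≤ 5 := by
      rw [sqrt_le_left (by norm_num), rescaledRadicand]
      have a1 : s ^ 2 ≤ 1 := pow_le_one₀ hs.1 hs.2
      have a2 : s ^ 4 ≤ 1 := pow_le_one₀ hs.1 hs.2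
      have a3 : s ^ 6 ≤ 1 := pow_le_one₀ hs.1 hs.2
      have a4 : t ^ 2 ≤ 1 := pow_le_one₀ ht.1.le ht.2
      have a5 : 0 ≤ s ^ 4 := by positivity
      have a6 : 0 ≤ t ^ 2 := by positivity
      have b1 : (t ^ 2 - s ^ 4) ^ 2 ≤ 1 := by
        rw [sq_le_one_iff_abs_le_one, abs_le]; constructor <;> linarith
      have b2 : 4 * t * (1 + s ^ 6) * (1 + s ^ 2 * t ^ 2) ≤ 4 * 1 * (1 + 1) * (1 + 1 * 1) := by
        gcongr; exact ht.2
      linarith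
    rw [one_div]
    exact inv_anti₀ (sqrt_pos.2 (rescaledRadicand_pos s ht.1)) h2
  have h2 := integrableOn_inv_sqrt_rescaledRadicand hs
  calc (1 / 5 : ℝ) = ∫ _ in Ioc (0 : ℝ) 1, (1 / 5 : ℝ) := by simp
    _ ≤ ∫ t in Ioc (0 : ℝ) 1, (√(rescaledRadicand s t))⁻¹ :=
      setIntegral_mono_on (by simp) (h2.mono_set Ioc_subset_Ioi_self) measurableSet_Ioc h1
    _ ≤ rescaledIntegral s := setIntegral_mono_set h2 (ae_of_all _ fun t => by positivity)
      Ioc_subset_Ioi_self.eventuallyLE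

theorem tendsto_rescaledIntegral :
    Tendsto rescaledIntegral (𝓝[Icc 0 1] 0) (𝓝 (rescaledIntegral 0)) := by
  refine tendsto_integral_filter_of_dominated_convergence
    (fun t => 2 * powerEnvelope (-(1 / 2)) (-2) t) ?_ ?_
    ((integrableOn_powerEnvelope (by norm_num) (by norm_num)).const_mul 2) ?_
  · exact Eventually.of_forall fun s =>
      (measurable_rescaledRadicand.comp measurable_prodMk_left).aestronglyMeasurable
  · filter_upwards [self_mem_nhdsWithin] with s hs
    filter_upwards [ae_restrict_mem measurableSet_Ioi] with t ht
    rw [norm_of_nonneg (by positivity)]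
    exact inv_sqrt_rescaledRadicand_le hs ht
  · filter_upwards [ae_restrict_mem measurableSet_Ioi] with t ht
    have h1 : Continuous fun s => √(rescaledRadicand s t) := by
      unfold rescaledRadicand; fun_prop
    exact ((h1.tendsto 0).inv₀ (sqrt_pos.2 (rescaledRadicand_pos 0 ht)).ne').mono_left
      nhdsWithin_le_nhds

/-! ### Half-angle substitution and the profile V / ω^{5/3} -/

theorem cos_two_mul_arctan (τ : ℝ) : cos (2 * arctan τ) = (1 - τ ^ 2) / (1 + τ ^ 2) := by
  rw [cos_two_mul, cos_sq_arctan]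
  field_simp; ring

theorem sin_two_mul_arctan (τ : ℝ) : sin (2 * arctan τ) = 2 * τ / (1 + τ ^ 2) := by
  have h := tan_mul_cos (cos_arctan_pos τ).ne'
  rw [tan_arctan] at h
  rw [sin_two_mul, ← h, mul_assoc, mul_assoc, ← sq, cos_sq_arctan]
  field_simp

/-- With τ = s³ and σ = st, both (σ² − τ²)² and τσ carry the factor s⁴, which comes out of the root
as s². -/
theorem resonanceJacobian_arctan (s t : ℝ) :
    resonanceJacobian (2 * arctan (s ^ 3)) (π - 2 * arctan (s * t)) =
      2 * s ^ 2 / ((1 + s ^ 6) * (1 + s ^ 2 * t ^ 2)) * √(rescaledRadicand s t) := by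
  rw [resonanceJacobian, cos_pi_sub, sin_pi_sub, cos_two_mul_arctan, cos_two_mul_arctan,
    sin_two_mul_arctan, sin_two_mul_arctan]
  have h0 : 0 ≤ 2 * s ^ 2 / ((1 + s ^ 6) * (1 + s ^ 2 * t ^ 2)) := by positivity
  refine Eq.trans (congrArg sqrt ?_) ((sqrt_mul (sq_nonneg _) _).trans
    (congrArg (· * √(rescaledRadicand s t)) (sqrt_sq h0)))
  have h1 : (s ^ 3) ^ 2 = s ^ 6 := by ring
  have h2 : (s * t) ^ 2 = s ^ 2 * t ^ 2 := by ring
  have h3 : 1 + s ^ 6 ≠ 0 := by positivity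
  have h4 : 1 + s ^ 2 * t ^ 2 ≠ 0 := by positivity
  rw [h1, h2, rescaledRadicand]
  field_simp
  ring

theorem lintegral_inv_resonanceJacobian {s : ℝ} (hs : 0 < s) :
    ∫⁻ k' in Ioo (0 : ℝ) 1,
        (ENNReal.ofReal (π * resonanceJacobian (2 * arctan (s ^ 3)) (π * k')))⁻¹ =
      ∫⁻ t in Ioi (0 : ℝ),
        ENNReal.ofReal ((1 + s ^ 6) / (π ^ 2 * s) * (√(rescaledRadicand s t))⁻¹) := by
  have hpi := pi_pos
  -- A decreasing bijection of (0, ∞) onto (0, 1). Its derivative contributes s/(1 + s²t²), which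
  -- cancels that denominator in the Jacobian and turns s⁻² into s⁻¹.
  set f : ℝ → ℝ := fun t => 1 - 2 / π * arctan (s * t) with hf
  have himage : f '' Ioi 0 = Ioo 0 1 := by
    ext z
    constructor
    · rintro ⟨t, ht, rfl⟩
      have h1 : 0 < arctan (s * t) := by rw [← arctan_zero]; exact arctan_strictMono (mul_pos hs ht)
      have h2 := arctan_lt_pi_div_two (s * t)
      have h3 : 2 / π * arctan (s * t) < 1 := by
        rw [div_mul_eq_mul_div, div_lt_one hpi]; linarith
      have h4 : 0 < 2 / π * arctan (s * t) := by positivity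
      exact ⟨by linarith, by linarith⟩
    · intro hz
      have h1 : 0 < π / 2 * (1 - z) := mul_pos (by positivity) (by linarith [hz.2])
      have h2 : π / 2 * (1 - z) < π / 2 := by nlinarith [hz.1]
      refine ⟨tan (π / 2 * (1 - z)) / s, div_pos (tan_pos_of_pos_of_lt_pi_div_two h1 h2) hs, ?_⟩
      rw [hf]
      simp only
      rw [mul_div_cancel₀ _ hs.ne', arctan_tan (by linarith) h2]
      field_simp; ring
  have hderiv : ∀ t ∈ Ioi (0 : ℝ), HasDerivWithinAt f (-(2 / π * (s / (1 + s ^ 2 * t ^ 2))))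
      (Ioi 0) t := by
    intro t _
    have h1 : HasDerivAt (fun t => s * t) (s * 1) t := (hasDerivAt_id t).const_mul s
    have h2 := ((h1.arctan).const_mul (2 / π)).const_sub 1
    refine (h2.congr_deriv ?_).hasDerivWithinAt
    rw [mul_pow]; ring
  have hinj : InjOn f (Ioi 0) := by
    intro a _ b _ hab
    have h1 : 2 / π * arctan (s * a) = 2 / π * arctan (s * b) := by
      simp only [hf] at hab; linarith
    have h2 := arctan_injective (mul_left_cancel₀ (by positivity) h1)
    exact mul_left_cancel₀ hs.ne' h2
  rw [← himage, lintegral_image_eq_lintegral_abs_deriv_mul measurableSet_Ioi hderiv hinj]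
  refine setLIntegral_congr_fun measurableSet_Ioi fun t ht => ?_
  have hQ := sqrt_pos.2 (rescaledRadicand_pos s ht)
  have h1 : π * f t = π - 2 * arctan (s * t) := by simp only [hf]; field_simp
  rw [h1, resonanceJacobian_arctan, ← ENNReal.ofReal_inv_of_pos (by positivity),
    ← ENNReal.ofReal_mul (abs_nonneg _), abs_neg, abs_of_pos (by positivity)]
  congr 1
  field_simp

theorem collisionRate_eq_rescaledIntegral {k s : ℝ} (hk : k ∈ Ioo (0 : ℝ) 1)
    (hs : s ∈ Ioc (0 : ℝ) 1) (hks : π * k = 2 * arctan (s ^ 3)) :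
    collisionRate k = ENNReal.ofReal (sin (π * k) ^ 2 *
      ((1 + s ^ 6) / (π ^ 2 * s) * rescaledIntegral s)) := by
  have hs0 : 0 < s := hs.1
  rw [collisionRate_eq_lintegral hk, ENNReal.ofReal_mul (sq_nonneg _), hks,
    lintegral_inv_resonanceJacobian hs.1, rescaledIntegral, ← integral_const_mul,
    ofReal_integral_eq_lintegral_ofReal]
  · exact (integrableOn_inv_sqrt_rescaledRadicand ⟨hs.1.le, hs.2⟩).const_mul _
  · exact ae_of_all _ fun t => by positivity

/-- `V k / ω(k) ^ (5 / 3)` as a function of `s = tan (π k / 2) ^ (1 / 3)`. -/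
def rateProfile (s : ℝ) : ℝ :=
  (2 / (1 + s ^ 6)) ^ (1 / 3 : ℝ) * ((1 + s ^ 6) / π ^ 2 * rescaledIntegral s)

theorem measurable_rateProfile : Measurable rateProfile := by
  have := measurable_rescaledIntegral
  unfold rateProfile; fun_prop

theorem exists_rateProfile_bounds :
    ∃ c C : ℝ, 0 < c ∧ ∀ s ∈ Icc (0 : ℝ) 1, c ≤ rateProfile s ∧ rateProfile s ≤ C := by
  have hpi := pi_pos
  refine ⟨1 / π ^ 2 * (1 / 5), 2 * (2 / π ^ 2 *
    ∫ t in Ioi (0 : ℝ), 2 * powerEnvelope (-(1 / 2)) (-2) t), by positivity, fun s hs => ?_⟩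
  have h6 : s ^ 6 ≤ 1 := pow_le_one₀ hs.1 hs.2
  have h60 : 0 ≤ s ^ 6 := pow_nonneg hs.1 6
  have h1 := one_fifth_le_rescaledIntegral hs
  have h2 := rescaledIntegral_le hs
  have h3 : 1 ≤ 2 / (1 + s ^ 6) := by rw [le_div_iff₀ (by positivity)]; linarith
  have h4 : 2 / (1 + s ^ 6) ≤ 2 := div_le_self (by norm_num) (by linarith)
  have h5 : 1 ≤ (2 / (1 + s ^ 6)) ^ (1 / 3 : ℝ) := one_le_rpow h3 (by norm_num)
  have h7 : (2 / (1 + s ^ 6)) ^ (1 / 3 : ℝ) ≤ 2 :=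
    (rpow_le_self_of_one_le h3 (by norm_num)).trans h4
  have h8 : 0 ≤ rescaledIntegral s := by linarith
  constructor
  · calc 1 / π ^ 2 * (1 / 5) ≤ (1 + s ^ 6) / π ^ 2 * rescaledIntegral s := by gcongr; linarith
      _ ≤ rateProfile s := le_mul_of_one_le_left (by positivity) h5
  · unfold rateProfile
    gcongr
    linarith

theorem tendsto_rateProfile :
    Tendsto rateProfile (𝓝[Icc 0 1] 0) (𝓝 (rateProfile 0)) := by
  have h1 : Continuous fun s : ℝ => (2 / (1 + s ^ 6)) ^ (1 / 3 : ℝ) := by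
    have : ∀ s : ℝ, 1 + s ^ 6 ≠ 0 := fun s => by positivity
    exact (by fun_prop (disch := assumption) : Continuous fun s : ℝ => 2 / (1 + s ^ 6)).rpow_const
      fun _ => Or.inr (by norm_num)
  have h2 : Continuous fun s : ℝ => (1 + s ^ 6) / π ^ 2 := by fun_prop
  exact ((h1.tendsto 0).mono_left nhdsWithin_le_nhds).mul
    (((h2.tendsto 0).mono_left nhdsWithin_le_nhds).mul tendsto_rescaledIntegral)

/-- The parameter `tan (π k / 2) ^ (1 / 3)`, restricted to `[0, 1]`. -/
def scaleParam (k : ℝ) : ℝ := max 0 (min 1 (tan (π * k / 2) ^ (1 / 3 : ℝ)))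

theorem scaleParam_mem (k : ℝ) : scaleParam k ∈ Icc (0 : ℝ) 1 :=
  ⟨le_max_left _ _, max_le zero_le_one (min_le_left _ _)⟩

theorem tendsto_scaleParam : Tendsto scaleParam (𝓝[>] 0) (𝓝[Icc 0 1] 0) := by
  refine tendsto_nhdsWithin_iff.2 ⟨?_, Eventually.of_forall scaleParam_mem⟩
  have h1 : ContinuousAt (fun k : ℝ => tan (π * k / 2)) 0 := by
    have : ContinuousAt tan (π * 0 / 2) := continuousAt_tan.2 (by simp)
    exact ContinuousAt.comp (f := fun k : ℝ => π * k / 2) this (by fun_prop)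
  have h2 : ContinuousAt scaleParam 0 :=
    continuousAt_const.max (continuousAt_const.min (h1.rpow_const (Or.inr (by norm_num))))
  have h3 : scaleParam 0 = 0 := by simp [scaleParam]
  have := h2.tendsto
  rw [h3] at this
  exact this.mono_left nhdsWithin_le_nhds

theorem scaleParam_spec {k : ℝ} (hk : k ∈ Ioc (0 : ℝ) (1 / 2)) :
    0 < scaleParam k ∧ π * k = 2 * arctan (scaleParam k ^ 3) := by
  have hpi := pi_pos
  have h0 : 0 < π * k / 2 := by have := hk.1; positivity
  have h1 : π * k / 2 ≤ π / 4 := by nlinarith [hk.2]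
  have ht0 : 0 < tan (π * k / 2) := tan_pos_of_pos_of_lt_pi_div_two h0 (by linarith)
  have ht1 : tan (π * k / 2) ≤ 1 := by
    rw [← tan_pi_div_four]
    exact strictMonoOn_tan.monotoneOn ⟨by linarith, by linarith⟩ ⟨by linarith, by linarith⟩ h1
  have h2 : scaleParam k = tan (π * k / 2) ^ (1 / 3 : ℝ) := by
    rw [scaleParam, min_eq_right (rpow_le_one ht0.le ht1 (by norm_num)),
      max_eq_right (rpow_nonneg ht0.le _)]
  have h3 : scaleParam k ^ 3 = tan (π * k / 2) := by
    rw [h2, ← rpow_natCast, ← rpow_mul ht0.le]; norm_num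
  refine ⟨by rw [h2]; exact rpow_pos_of_pos ht0 _, ?_⟩
  rw [h3, arctan_tan (by linarith) (by linarith)]; ring

/-- Since ω = 2s³/(1 + s⁶), the singular factor 1/s absorbs ω^{1/3} out of ω², leaving ω^{5/3}. -/
theorem collisionRate_eq_rateProfile {k : ℝ} (hk : k ∈ Ioc (0 : ℝ) (1 / 2)) :
    collisionRate k =
      ENNReal.ofReal (omega k ^ (5 / 3 : ℝ) * rateProfile (scaleParam k)) := by
  obtain ⟨h0, h1⟩ := scaleParam_spec hk
  have hk1 : k ∈ Ioo (0 : ℝ) 1 := ⟨hk.1, by linarith [hk.2]⟩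
  rw [collisionRate_eq_rescaledIntegral hk1 ⟨h0, (scaleParam_mem k).2⟩ h1,
    omega_of_mem (Ioo_subset_Icc_self hk1)]
  congr 1
  set s := scaleParam k
  set X := sin (π * k) with hX
  have hXs : X = 2 / (1 + s ^ 6) * s ^ 3 := by
    rw [hX, h1, sin_two_mul_arctan]; ring_nf
  have hX0 : 0 < X := by rw [hXs]; positivity
  have h2 : X ^ (1 / 3 : ℝ) = (2 / (1 + s ^ 6)) ^ (1 / 3 : ℝ) * s := by
    rw [hXs, mul_rpow (by positivity) (by positivity), ← rpow_natCast s 3, ← rpow_mul h0.le]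
    norm_num
  have h3 : X ^ 2 = X ^ (5 / 3 : ℝ) * X ^ (1 / 3 : ℝ) := by
    rw [← rpow_add hX0, ← rpow_natCast]; norm_num
  rw [h3, h2, rateProfile]
  field_simp

theorem rateProfile_nonneg {s : ℝ} (hs : s ∈ Icc (0 : ℝ) 1) : 0 ≤ rateProfile s := by
  have h1 := one_fifth_le_rescaledIntegral hs
  have : 0 ≤ rescaledIntegral s := by linarith
  unfold rateProfile; positivity

theorem omega_nonneg (k : ℝ) : 0 ≤ omega k := abs_nonneg _

theorem collisionRate_zero : collisionRate 0 = 0 := by simp [collisionRate, omega]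

theorem collisionRate_eq_rateProfile_abs {k : ℝ} (hk : |k| ≤ 1 / 2) :
    collisionRate k =
      ENNReal.ofReal (omega k ^ (5 / 3 : ℝ) * rateProfile (scaleParam |k|)) := by
  rcases lt_trichotomy k 0 with h | h | h
  · rw [abs_of_neg h] at hk ⊢
    rw [← omega_neg, ← collisionRate_eq_rateProfile ⟨by linarith, hk⟩]
    simpa using collisionRate_neg_of_mem (k := -k) ⟨by linarith, by linarith⟩
  · subst h
    simp [collisionRate_zero, omega]
  · rw [abs_of_pos h] at hk ⊢
    exact collisionRate_eq_rateProfile ⟨h, hk⟩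

theorem collisionRate_ne_top (k : ℝ) : collisionRate k ≠ ∞ := by
  rw [← collisionRate_sub_int k (round k), collisionRate_eq_rateProfile_abs (abs_sub_round k)]
  exact ENNReal.ofReal_ne_top

theorem V_eq {k : ℝ} (hk : |k| ≤ 1 / 2) :
    V k = omega k ^ (5 / 3 : ℝ) * rateProfile (scaleParam |k|) := by
  rw [V, collisionRate_eq_rateProfile_abs hk, ENNReal.toReal_ofReal]
  exact mul_nonneg (rpow_nonneg (omega_nonneg k) _) (rateProfile_nonneg (scaleParam_mem _))

/-! ### Size, symmetry and measurability of ω and V -/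

theorem continuous_omega : Continuous omega := by unfold omega; fun_prop

theorem omega_le_one (k : ℝ) : omega k ≤ 1 := abs_sin_le_one _

theorem two_mul_le_omega {k : ℝ} (h0 : 0 ≤ k) (h1 : k ≤ 1 / 2) : 2 * k ≤ omega k := by
  rw [omega_of_mem ⟨h0, by linarith⟩]
  have h := mul_le_sin (x := π * k) (by positivity) (by nlinarith [pi_pos])
  have e : 2 / π * (π * k) = 2 * k := by field_simp
  linarith

theorem omega_le_pi_mul {k : ℝ} (h0 : 0 ≤ k) : omega k ≤ π * k := by
  rw [omega]
  refine abs_sin_le_abs.trans_eq (abs_of_nonneg (by positivity))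

theorem omega_pos {k : ℝ} (hk : k ∈ Ioc (0 : ℝ) (1 / 2)) : 0 < omega k := by
  linarith [two_mul_le_omega hk.1.le hk.2, hk.1]

theorem deriv_omega_of_mem {k : ℝ} (hk : k ∈ Ioc (0 : ℝ) (1 / 2)) :
    deriv omega k = π * cos (π * k) := by
  refine (hasDerivAt_omega_of_pos ?_).deriv
  rw [← omega_of_mem ⟨hk.1.le, by linarith [hk.2]⟩]
  exact omega_pos hk

theorem deriv_omega_neg (k : ℝ) : deriv omega (-k) = -deriv omega k := by
  have h := deriv_comp_neg omega k
  rw [funext omega_neg] at h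
  rw [h, neg_neg]

theorem abs_deriv_omega_le {k : ℝ} (hk : k ∈ Ioc (0 : ℝ) (1 / 2)) : |deriv omega k| ≤ π := by
  rw [deriv_omega_of_mem hk, abs_mul, abs_of_pos pi_pos]
  exact mul_le_of_le_one_right pi_pos.le (abs_cos_le_one _)

theorem V_nonneg (k : ℝ) : 0 ≤ V k := ENNReal.toReal_nonneg

theorem V_sub_int (k : ℝ) (n : ℤ) : V (k - n) = V k := by rw [V, V, collisionRate_sub_int]

/-- A closed formula valid on the whole line, from which the measurability and global bounds of V
are read off. -/
theorem V_eq_round (k : ℝ) :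
    V k = omega k ^ (5 / 3 : ℝ) * rateProfile (scaleParam |k - round k|) := by
  rw [← V_sub_int k (round k), V_eq (abs_sub_round k), omega_sub_int]

theorem V_neg (k : ℝ) : V (-k) = V k := by
  have h : |-(k - round k)| ≤ 1 / 2 := by rw [abs_neg]; exact abs_sub_round k
  have e : -k = -(k - round k) - (round k : ℤ) := by ring
  rw [e, V_sub_int, V_eq h, V_eq_round k, omega_neg, omega_sub_int, abs_neg]

theorem measurable_V : Measurable V := by
  have h1 : Measurable fun k : ℝ => k - (round k : ℝ) := by
    simp_rw [round_eq]
    exact measurable_id.sub ((measurable_from_top (f := fun n : ℤ => (n : ℝ))).comp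
      (Int.measurable_floor.comp (measurable_id.add_const _)))
  have h2 : Measurable scaleParam := by
    have : Measurable tan := by
      have : tan = fun x => sin x / cos x := funext tan_eq_sin_div_cos
      rw [this]; fun_prop
    unfold scaleParam; fun_prop
  have h3 : Measurable fun k : ℝ => |k - (round k : ℝ)| := by
    simp_rw [← Real.norm_eq_abs]; exact h1.norm
  rw [funext V_eq_round]
  exact (continuous_omega.measurable.pow_const _).mul
    (measurable_rateProfile.comp (h2.comp h3))

theorem exists_V_bounds : ∃ c C : ℝ, 0 < c ∧ 0 < C ∧
    ∀ k, c * omega k ^ (5 / 3 : ℝ) ≤ V k ∧ V k ≤ C * omega k ^ (5 / 3 : ℝ) := by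
  obtain ⟨c, C, hc, h⟩ := exists_rateProfile_bounds
  have h0 := h 0 ⟨le_rfl, zero_le_one⟩
  refine ⟨c, C, hc, by linarith, fun k => ?_⟩
  have h1 := h _ (scaleParam_mem |k - round k|)
  have h2 := rpow_nonneg (omega_nonneg k) (5 / 3)
  rw [V_eq_round, mul_comm c, mul_comm C]
  exact ⟨mul_le_mul_of_nonneg_left h1.1 h2, mul_le_mul_of_nonneg_left h1.2 h2⟩

theorem V_pos {k : ℝ} (hk : k ∈ Ioc (0 : ℝ) (1 / 2)) : 0 < V k := by
  obtain ⟨c, C, hc, -, h⟩ := exists_V_bounds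
  have := rpow_pos_of_pos (omega_pos hk) (5 / 3)
  exact (by positivity : 0 < c * omega k ^ (5 / 3 : ℝ)).trans_le (h k).1

theorem rateProfile_zero_pos : 0 < rateProfile 0 := by
  obtain ⟨c, C, hc, h⟩ := exists_rateProfile_bounds
  exact hc.trans_le (h 0 ⟨le_rfl, zero_le_one⟩).1

theorem tendsto_rateProfile_scaleParam :
    Tendsto (fun k => rateProfile (scaleParam k)) (𝓝[>] 0) (𝓝 (rateProfile 0)) :=
  tendsto_rateProfile.comp tendsto_scaleParam

theorem tendsto_V_div_omega :
    Tendsto (fun k : ℝ => |sin (π * k)| ^ (-(5 / 3) : ℝ) * V k) (𝓝[≠] 0)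
      (𝓝 (rateProfile 0)) := by
  have h1 : Tendsto (fun k : ℝ => |k|) (𝓝[≠] 0) (𝓝[>] 0) := tendsto_abs_nhdsNE_zero
  refine (tendsto_rateProfile_scaleParam.comp h1).congr' ?_
  have h2 : ∀ᶠ k : ℝ in 𝓝[≠] 0, |k| ∈ Ioc (0 : ℝ) (1 / 2) :=
    h1.eventually (Ioc_mem_nhdsGT (by norm_num))
  filter_upwards [h2] with k hk
  have h3 : omega |k| = omega k := by
    rcases abs_choice k with h | h <;> rw [h]
    exact omega_neg k
  have h4 : 0 < omega k := by rw [← h3]; exact omega_pos hk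
  have h5 : |sin (π * k)| = omega k := rfl
  rw [V_eq hk.2, h5, ← mul_assoc, ← rpow_add h4]
  simp

/-- The worst weight is j = 2, where ω^{5/3 − 2} = ω^{-1/3} is still integrable at 0. -/
theorem V_div_omega_pow_le {C : ℝ} (hC : ∀ k, V k ≤ C * omega k ^ (5 / 3 : ℝ)) (hC0 : 0 < C)
    {j : ℕ} (hj : j ≤ 2) {k : ℝ} (hk : k ∈ Ioc (0 : ℝ) (1 / 2)) :
    V k / omega k ^ j ≤ C * k ^ (-(1 / 3) : ℝ) := by
  have h0 := omega_pos hk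
  have hj' : (j : ℝ) ≤ 2 := by exact_mod_cast hj
  calc V k / omega k ^ j ≤ C * omega k ^ (5 / 3 : ℝ) / omega k ^ j := by gcongr; exact hC k
    _ = C * omega k ^ (5 / 3 - j : ℝ) := by rw [rpow_sub h0, rpow_natCast, mul_div_assoc]
    _ ≤ C * omega k ^ (-(1 / 3) : ℝ) := by
      gcongr C * ?_
      exact rpow_le_rpow_of_exponent_ge h0 (omega_le_one k) (by linarith)
    _ ≤ C * k ^ (-(1 / 3) : ℝ) := by
      gcongr C * ?_
      exact rpow_le_rpow_of_nonpos hk.1 (by linarith [two_mul_le_omega hk.1.le hk.2, hk.1])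
        (by norm_num)

theorem integrableOn_rpow_Ioc {r : ℝ} (hr : -1 < r) (a : ℝ) (ha : 0 ≤ a) :
    IntegrableOn (fun k : ℝ => k ^ r) (Ioc 0 a) :=
  (intervalIntegrable_iff_integrableOn_Ioc_of_le ha).1
    (intervalIntegral.intervalIntegrable_rpow' hr)

theorem measurable_V_div_omega_pow (j : ℕ) : Measurable fun k => V k / omega k ^ j :=
  measurable_V.div (continuous_omega.measurable.pow_const j)

theorem integrableOn_V_div_omega_pow {j : ℕ} (hj : j ≤ 2) :
    IntegrableOn (fun k => V k / omega k ^ j) (Ioc 0 (1 / 2)) := by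
  obtain ⟨c, C, -, hC0, h⟩ := exists_V_bounds
  refine Integrable.mono' ((integrableOn_rpow_Ioc (r := -(1 / 3)) (by norm_num) (1 / 2)
    (by norm_num)).const_mul C) (measurable_V_div_omega_pow j).aestronglyMeasurable ?_
  filter_upwards [ae_restrict_mem measurableSet_Ioc] with k hk
  rw [norm_of_nonneg (div_nonneg (V_nonneg k) (pow_nonneg (omega_nonneg k) j))]
  exact V_div_omega_pow_le (fun k => (h k).2) hC0 hj hk

theorem intervalIntegrable_V_div_omega_pow {j : ℕ} (hj : j ≤ 2) :
    IntervalIntegrable (fun k => V k / omega k ^ j) volume (-(1 / 2)) (1 / 2) := by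
  have h1 : IntervalIntegrable (fun k => V k / omega k ^ j) volume 0 (1 / 2) :=
    (intervalIntegrable_iff_integrableOn_Ioc_of_le (by norm_num)).2
      (integrableOn_V_div_omega_pow hj)
  have h2 := (IntervalIntegrable.iff_comp_neg (by finiteness)).1 h1
  simp only [V_neg, omega_neg, neg_zero] at h2
  exact h2.symm.trans h1

/-! ### The factor D and the splitting into damping and transport -/

theorem norm_defect_le {ε p : ℝ} (hε : 0 < ε) (hp : 0 < p) (ξ k : ℝ) :
    ‖defect ε p ξ k‖ ≤ 2 := by
  have hA : 0 < ε ^ (8 / 5 : ℝ) * p := mul_pos (rpow_pos_of_pos hε _) hp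
  have hV := V_nonneg k
  unfold defect
  refine (norm_sub_le _ _).trans ?_
  have h1 : V k ≤ ‖((ε ^ (8 / 5 : ℝ) * p + V k : ℝ) : ℂ)
      + Complex.I * ((ε * deriv omega k * ξ : ℝ) : ℂ)‖ := by
    refine le_trans ?_ (Complex.abs_re_le_norm _)
    have : (((ε ^ (8 / 5 : ℝ) * p + V k : ℝ) : ℂ)
      + Complex.I * ((ε * deriv omega k * ξ : ℝ) : ℂ)).re = ε ^ (8 / 5 : ℝ) * p + V k := by simp
    rw [this, abs_of_pos (by positivity)]
    linarith
  rw [norm_div, norm_one, Complex.norm_real, norm_of_nonneg hV]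
  linarith [div_le_one_of_le₀ h1 (norm_nonneg _)]

theorem re_defect {ε p : ℝ} (hε : 0 < ε) (hp : 0 < p) (ξ k : ℝ) :
    (defect ε p ξ k).re =
      -(ε ^ (8 / 5 : ℝ) * p * (ε ^ (8 / 5 : ℝ) * p + V k) + (ε * deriv omega k * ξ) ^ 2) /
        ((ε ^ (8 / 5 : ℝ) * p + V k) ^ 2 + (ε * deriv omega k * ξ) ^ 2) := by
  have hA : 0 < ε ^ (8 / 5 : ℝ) * p := mul_pos (rpow_pos_of_pos hε _) hp
  have hV := V_nonneg k
  unfold defect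
  generalize ε ^ (8 / 5 : ℝ) * p = A at *
  generalize ε * deriv omega k * ξ = B
  generalize V k = v at *
  have h2 : (A + v) ^ 2 + B ^ 2 ≠ 0 := by positivity
  have h3 : Complex.normSq (((A + v : ℝ) : ℂ) + Complex.I * (B : ℂ)) = (A + v) ^ 2 + B ^ 2 := by
    rw [Complex.normSq_apply]; simp; ring
  rw [Complex.sub_re, Complex.div_re, h3]
  simp
  field_simp
  ring

theorem defect_neg (ε p ξ k : ℝ) :
    defect ε p ξ (-k) = (starRingEnd ℂ) (defect ε p ξ k) := by
  simp only [defect, V_neg, deriv_omega_neg, map_sub, map_div₀, map_add, map_mul, map_one,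
    Complex.conj_ofReal, Complex.conj_I]
  congr 3
  push_cast; ring

theorem measurable_defect (ε : ℝ) :
    Measurable fun q : (ℝ × ℝ) × ℝ => defect ε q.1.1 q.1.2 q.2 := by
  have h1 := measurable_V
  have h2 := measurable_deriv omega
  have h3 : Measurable fun q : (ℝ × ℝ) × ℝ => (V q.2 : ℂ) :=
    Complex.measurable_ofReal.comp (h1.comp measurable_snd)
  have h4 : Measurable fun q : (ℝ × ℝ) × ℝ => ε ^ (8 / 5 : ℝ) * q.1.1 + V q.2 :=
    ((measurable_fst.comp measurable_fst).const_mul _).add (h1.comp measurable_snd)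
  have h5 : Measurable fun q : (ℝ × ℝ) × ℝ => ε * deriv omega q.2 * q.1.2 :=
    ((h2.comp measurable_snd).const_mul ε).mul (measurable_snd.comp measurable_fst)
  simp only [defect]
  refine Measurable.sub_const ?_ 1
  refine Measurable.div h3 ?_
  refine Measurable.add (Complex.measurable_ofReal.comp h4) ?_
  exact Measurable.const_mul (Complex.measurable_ofReal.comp h5) _

theorem intervalIntegrable_defect_mul {ε p : ℝ} (hε : 0 < ε) (hp : 0 < p) (ξ : ℝ) {j : ℕ}
    (hj : j ≤ 2) :
    IntervalIntegrable (fun k => defect ε p ξ k * ((V k / omega k ^ j : ℝ) : ℂ)) volume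
      (-(1 / 2)) (1 / 2) := by
  refine ((intervalIntegrable_V_div_omega_pow hj).const_mul 2).mono_fun' ?_ ?_
  · have h1 : Measurable fun k : ℝ => ((p, ξ), k) := measurable_prodMk_left
    have h2 := (measurable_defect ε).comp h1
    have h3 : Measurable fun k => ((V k / omega k ^ j : ℝ) : ℂ) :=
      Complex.measurable_ofReal.comp (measurable_V_div_omega_pow j)
    exact (h2.mul h3).aestronglyMeasurable
  · refine ae_of_all _ fun k => ?_
    have h0 : 0 ≤ V k / omega k ^ j := div_nonneg (V_nonneg k) (pow_nonneg (omega_nonneg k) j)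
    simp only [norm_mul, Complex.norm_real, norm_of_nonneg h0]
    exact mul_le_mul_of_nonneg_right (norm_defect_le hε hp ξ k) h0

/-- Folding the interval at 0 pairs f(k) with its conjugate, so the imaginary parts cancel. -/
theorem integral_of_conj_symm {f : ℝ → ℂ} {a : ℝ} (ha : 0 ≤ a)
    (hf : ∀ k, f (-k) = (starRingEnd ℂ) (f k)) (hi : IntervalIntegrable f volume (-a) a) :
    ∫ k in -a..a, f k = ((2 * ∫ k in Ioc 0 a, (f k).re : ℝ) : ℂ) := by
  have h0 : (0 : ℝ) ∈ uIcc (-a) a := by rw [uIcc_of_le (by linarith)]; exact ⟨by linarith, ha⟩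
  have hi1 : IntervalIntegrable f volume (-a) 0 :=
    hi.mono_set (uIcc_subset_uIcc left_mem_uIcc h0)
  have hi2 : IntervalIntegrable f volume 0 a := hi.mono_set (uIcc_subset_uIcc h0 right_mem_uIcc)
  have h1 : ∫ k in -a..0, f k = ∫ k in 0..a, f (-k) := by
    rw [intervalIntegral.integral_comp_neg, neg_zero]
  have hi3 : IntervalIntegrable (fun k => f (-k)) volume 0 a := by
    have := (IntervalIntegrable.iff_comp_neg (by finiteness)).1 hi1
    rw [neg_neg, neg_zero] at this
    exact this.symm
  rw [← intervalIntegral.integral_add_adjacent_intervals hi1 hi2, h1,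
    ← intervalIntegral.integral_add hi3 hi2, ← integral_const_mul,
    ← intervalIntegral.integral_of_le ha, ← intervalIntegral.integral_ofReal]
  refine intervalIntegral.integral_congr fun k _ => ?_
  simp only [hf, add_comm _ (f k), Complex.add_conj]

/-- The common form `ε ^ ((3 j - 8) / 5) ∫ D V / ω ^ j` of the three symbols, for `j = 0, 1, 2`. -/
def scaledSymbol (j : ℕ) (ε : ℝ) (x : ℝ × ℝ) : ℂ :=
  ((ε ^ ((3 * j - 8) / 5 : ℝ) : ℝ) : ℂ) *
    ∫ k in (-(1 / 2) : ℝ)..(1 / 2), defect ε x.1 x.2 k * ((V k / omega k ^ j : ℝ) : ℂ)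

theorem a₁_eq_scaledSymbol (ε : ℝ) : a₁ ε = scaledSymbol 0 ε := by
  funext x
  simp only [a₁, scaledSymbol, pow_zero, div_one]
  norm_num

theorem a₂_eq_scaledSymbol {ε : ℝ} (hε : 0 < ε) : a₂ ε = scaledSymbol 1 ε := by
  funext x
  have h : ∀ k, defect ε x.1 x.2 k * ((ε ^ (3 / 5 : ℝ) * V k / omega k : ℝ) : ℂ) =
      ((ε ^ (3 / 5 : ℝ) : ℝ) : ℂ) * (defect ε x.1 x.2 k * ((V k / omega k ^ 1 : ℝ) : ℂ)) := by
    intro k; push_cast; ring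
  simp only [a₂, scaledSymbol, h]
  rw [intervalIntegral.integral_const_mul, ← mul_assoc, ← Complex.ofReal_mul, ← rpow_add hε]
  norm_num

theorem a₃_eq_scaledSymbol {ε : ℝ} (hε : 0 < ε) : a₃ ε = scaledSymbol 2 ε := by
  funext x
  have h : ∀ k, defect ε x.1 x.2 k * ((ε ^ (3 / 5 : ℝ) * V k / omega k ^ 2 : ℝ) : ℂ) =
      ((ε ^ (3 / 5 : ℝ) : ℝ) : ℂ) * (defect ε x.1 x.2 k * ((V k / omega k ^ 2 : ℝ) : ℂ)) := by
    intro k; push_cast; ring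
  simp only [a₃, scaledSymbol, h]
  rw [intervalIntegral.integral_const_mul, ← mul_assoc, ← Complex.ofReal_mul, ← rpow_neg_one,
    ← rpow_add hε]
  norm_num

theorem stronglyMeasurable_scaledSymbol (j : ℕ) (ε : ℝ) : StronglyMeasurable (scaledSymbol j ε) := by
  unfold scaledSymbol
  refine StronglyMeasurable.const_mul ?_ _
  simp only [intervalIntegral.integral_of_le (show (-(1 / 2) : ℝ) ≤ 1 / 2 by norm_num)]
  refine StronglyMeasurable.integral_prod_right (Measurable.stronglyMeasurable ?_)
  exact (measurable_defect ε).mul (Complex.measurable_ofReal.comp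
    ((measurable_V_div_omega_pow j).comp measurable_snd))

/-- The power of ε in front has exponent (3j − 8)/5 < 0, hence is at most 1 here, and |D| ≤ 2
suffices. -/
theorem norm_scaledSymbol_le_of_one_le {ε : ℝ} (hε : 1 ≤ ε) {x : ℝ × ℝ} (hx : 0 < x.1) {j : ℕ}
    (hj : j ≤ 2) :
    ‖scaledSymbol j ε x‖ ≤ ∫ k in (-(1 / 2) : ℝ)..(1 / 2), 2 * (V k / omega k ^ j) := by
  have hε0 : 0 < ε := by linarith
  have hj' : (j : ℝ) ≤ 2 := by exact_mod_cast hj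
  rw [scaledSymbol, norm_mul, Complex.norm_real, norm_of_nonneg (rpow_nonneg hε0.le _)]
  refine (mul_le_of_le_one_left (norm_nonneg _)
    (rpow_le_one_of_one_le_of_nonpos hε (by linarith))).trans ?_
  refine intervalIntegral.norm_integral_le_of_norm_le (by norm_num) (ae_of_all _ fun k _ => ?_)
    ((intervalIntegrable_V_div_omega_pow hj).const_mul 2)
  have h0 : 0 ≤ V k / omega k ^ j := div_nonneg (V_nonneg k) (pow_nonneg (omega_nonneg k) j)
  rw [norm_mul, Complex.norm_real, norm_of_nonneg h0]
  exact mul_le_mul_of_nonneg_right (norm_defect_le hε0 hx _ k) h0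

/-- The part of the symbol due to the damping `ε ^ (8 / 5) p`. -/
def dampingPart (j : ℕ) (ε p ξ : ℝ) : ℝ :=
  ε ^ ((3 * j - 8) / 5 : ℝ) * ∫ k in Ioc (0 : ℝ) (1 / 2),
    ε ^ (8 / 5 : ℝ) * p * (ε ^ (8 / 5 : ℝ) * p + V k) /
      ((ε ^ (8 / 5 : ℝ) * p + V k) ^ 2 + (ε * deriv omega k * ξ) ^ 2) * (V k / omega k ^ j)

/-- The part of the symbol due to the transport term `ε ω'(k) ξ`. -/
def transportPart (j : ℕ) (ε p ξ : ℝ) : ℝ :=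
  ε ^ ((3 * j - 8) / 5 : ℝ) * ∫ k in Ioc (0 : ℝ) (1 / 2),
    (ε * deriv omega k * ξ) ^ 2 /
      ((ε ^ (8 / 5 : ℝ) * p + V k) ^ 2 + (ε * deriv omega k * ξ) ^ 2) * (V k / omega k ^ j)

theorem integrableOn_mul_V_div_omega_pow {f : ℝ → ℝ} (hf : Measurable f) (h0 : ∀ k, 0 ≤ f k)
    (h1 : ∀ k, f k ≤ 1) {j : ℕ} (hj : j ≤ 2) :
    IntegrableOn (fun k => f k * (V k / omega k ^ j)) (Ioc 0 (1 / 2)) := by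
  refine Integrable.mono' (integrableOn_V_div_omega_pow hj)
    (hf.mul (measurable_V_div_omega_pow j)).aestronglyMeasurable (ae_of_all _ fun k => ?_)
  have h : 0 ≤ V k / omega k ^ j := div_nonneg (V_nonneg k) (pow_nonneg (omega_nonneg k) j)
  rw [norm_of_nonneg (mul_nonneg (h0 k) h)]
  exact mul_le_of_le_one_left h (h1 k)

theorem dampingRatio_le_one {A v : ℝ} (hA : 0 < A) (hv : 0 ≤ v) (B : ℝ) :
    A * (A + v) / ((A + v) ^ 2 + B ^ 2) ≤ 1 := by
  rw [div_le_one (by positivity)]; nlinarith [mul_nonneg (add_nonneg hA.le hv) hv]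

theorem transportRatio_le_one {A v : ℝ} (hA : 0 < A) (hv : 0 ≤ v) (B : ℝ) :
    B ^ 2 / ((A + v) ^ 2 + B ^ 2) ≤ 1 := by
  rw [div_le_one (by positivity)]; nlinarith

theorem measurable_dampingRatio (A ε ξ : ℝ) : Measurable fun k =>
    A * (A + V k) / ((A + V k) ^ 2 + (ε * deriv omega k * ξ) ^ 2) := by
  have h1 := measurable_V
  have h2 := measurable_deriv omega
  fun_prop

theorem measurable_transportRatio (A ε ξ : ℝ) : Measurable fun k =>
    (ε * deriv omega k * ξ) ^ 2 / ((A + V k) ^ 2 + (ε * deriv omega k * ξ) ^ 2) := by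
  have h1 := measurable_V
  have h2 := measurable_deriv omega
  fun_prop

theorem scaledSymbol_eq {ε : ℝ} (hε : 0 < ε) {x : ℝ × ℝ} (hx : 0 < x.1) {j : ℕ} (hj : j ≤ 2) :
    scaledSymbol j ε x =
      ((-(2 * (dampingPart j ε x.1 x.2 + transportPart j ε x.1 x.2)) : ℝ) : ℂ) := by
  have hA : 0 < ε ^ (8 / 5 : ℝ) * x.1 := mul_pos (rpow_pos_of_pos hε _) hx
  rw [scaledSymbol, integral_of_conj_symm (by norm_num) (fun k => ?_)
    (intervalIntegrable_defect_mul hε hx x.2 hj), ← Complex.ofReal_mul]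
  · congr 1
    rw [dampingPart, transportPart, ← mul_add, ← integral_add]
    · rw [mul_left_comm 2, ← mul_neg, ← mul_neg, ← integral_neg]
      congr 2
      refine integral_congr_ae (ae_of_all _ fun k => ?_)
      simp only [Complex.re_mul_ofReal, re_defect hε hx]
      rw [← add_mul, ← add_div, ← neg_mul, neg_div]
    · exact integrableOn_mul_V_div_omega_pow (measurable_dampingRatio _ _ _)
        (fun k => by have := V_nonneg k; positivity)
        (fun k => dampingRatio_le_one hA (V_nonneg k) _) hj
    · exact integrableOn_mul_V_div_omega_pow (measurable_transportRatio _ _ _)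
        (fun k => by positivity) (fun k => transportRatio_le_one hA (V_nonneg k) _) hj
  · rw [defect_neg, V_neg, omega_neg, map_mul, Complex.conj_ofReal]

/-! ### The damping part -/

/-- The left side is at most min(A, v), which lies below every geometric mean of A and v. -/
theorem dampingRatio_mul_le {A v θ : ℝ} (hA : 0 < A) (hv : 0 ≤ v) (hθ0 : 0 ≤ θ) (hθ1 : θ ≤ 1)
    (B : ℝ) : A * (A + v) / ((A + v) ^ 2 + B ^ 2) * v ≤ A ^ (1 - θ) * v ^ θ := by
  have h1 : A * (A + v) / ((A + v) ^ 2 + B ^ 2) * v ≤ v :=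
    mul_le_of_le_one_left hv (dampingRatio_le_one hA hv B)
  have h2 : A * (A + v) / ((A + v) ^ 2 + B ^ 2) * v ≤ A := by
    rw [div_mul_eq_mul_div, div_le_iff₀ (by positivity)]
    nlinarith [mul_nonneg (mul_nonneg hA.le (add_nonneg hA.le hv)) hA.le,
      mul_nonneg hA.le (sq_nonneg B)]
  rcases le_total v A with h | h
  · calc _ ≤ v := h1
      _ = v ^ (1 - θ) * v ^ θ := by
        rcases hv.eq_or_lt with rfl | hv'
        · rcases hθ0.eq_or_lt with rfl | h
          · simp
          · rw [zero_rpow h.ne', mul_zero]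
        · rw [← rpow_add hv']; simp
      _ ≤ A ^ (1 - θ) * v ^ θ := by gcongr
  · calc _ ≤ A := h2
      _ = A ^ (1 - θ) * A ^ θ := by rw [← rpow_add hA]; simp
      _ ≤ A ^ (1 - θ) * v ^ θ := by gcongr

/-- Interpolation with θ = j/3. For j = 1, 2 a positive power of ε requires θ < 3j/8, and
integrability of k^{5θ/3 − j} requires θ > 3(j − 1)/5; j/3 meets both, leaving ε^{j/15} and
k^{-4j/9}. -/
theorem exists_dampingPart_le {j : ℕ} (hj : j ≤ 2) : ∃ K : ℝ, 0 ≤ K ∧ ∀ ε p ξ : ℝ, 0 < ε → 0 < p →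
    0 ≤ dampingPart j ε p ξ ∧
      dampingPart j ε p ξ ≤ K * p ^ (1 - j / 3 : ℝ) * ε ^ (j / 15 : ℝ) := by
  obtain ⟨c, C, -, hC0, hV⟩ := exists_V_bounds
  have hj' : (j : ℝ) ≤ 2 := by exact_mod_cast hj
  have hint := integrableOn_rpow_Ioc (r := -(4 * j / 9)) (by linarith) (1 / 2) (by norm_num)
  refine ⟨C ^ (j / 3 : ℝ) * ∫ k in Ioc (0 : ℝ) (1 / 2), k ^ (-(4 * j / 9) : ℝ), ?_, ?_⟩
  · refine mul_nonneg (by positivity) (setIntegral_nonneg measurableSet_Ioc fun k hk => ?_)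
    exact rpow_nonneg hk.1.le _
  intro ε p ξ hε hp
  have hA : 0 < ε ^ (8 / 5 : ℝ) * p := mul_pos (rpow_pos_of_pos hε _) hp
  constructor
  · refine mul_nonneg (rpow_nonneg hε.le _) (integral_nonneg fun k => ?_)
    have h1 := V_nonneg k
    have h2 := omega_nonneg k
    simp only [Pi.zero_apply]
    positivity
  have hpt : ∀ k ∈ Ioc (0 : ℝ) (1 / 2), ε ^ (8 / 5 : ℝ) * p * (ε ^ (8 / 5 : ℝ) * p + V k) /
      ((ε ^ (8 / 5 : ℝ) * p + V k) ^ 2 + (ε * deriv omega k * ξ) ^ 2) * (V k / omega k ^ j) ≤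
      (ε ^ (8 / 5 : ℝ) * p) ^ (1 - j / 3 : ℝ) * C ^ (j / 3 : ℝ) * k ^ (-(4 * j / 9) : ℝ) := by
    intro k hk
    have h0 := omega_pos hk
    have h1 := dampingRatio_mul_le hA (V_nonneg k) (θ := (j / 3 : ℝ)) (by positivity)
      (by linarith) (ε * deriv omega k * ξ)
    have h2 : V k ^ (j / 3 : ℝ) ≤ C ^ (j / 3 : ℝ) * omega k ^ (5 * j / 9 : ℝ) := by
      calc V k ^ (j / 3 : ℝ) ≤ (C * omega k ^ (5 / 3 : ℝ)) ^ (j / 3 : ℝ) :=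
            rpow_le_rpow (V_nonneg k) (hV k).2 (by positivity)
        _ = C ^ (j / 3 : ℝ) * omega k ^ (5 * j / 9 : ℝ) := by
            rw [mul_rpow hC0.le (by positivity), ← rpow_mul h0.le]; ring_nf
    have h3 : omega k ^ (-(4 * j / 9) : ℝ) ≤ k ^ (-(4 * j / 9) : ℝ) :=
      rpow_le_rpow_of_nonpos hk.1 (by linarith [two_mul_le_omega hk.1.le hk.2, hk.1])
        (by have : (0 : ℝ) ≤ j := by positivity
            linarith)
    rw [← mul_div_assoc]
    calc _ ≤ (ε ^ (8 / 5 : ℝ) * p) ^ (1 - j / 3 : ℝ) *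
          (C ^ (j / 3 : ℝ) * omega k ^ (5 * j / 9 : ℝ)) / omega k ^ j := by
          refine div_le_div_of_nonneg_right (h1.trans ?_) (by positivity)
          gcongr
      _ = (ε ^ (8 / 5 : ℝ) * p) ^ (1 - j / 3 : ℝ) * C ^ (j / 3 : ℝ) *
          omega k ^ (-(4 * j / 9) : ℝ) := by
          have : (-(4 * j / 9) : ℝ) = 5 * j / 9 - j := by ring
          rw [this, rpow_sub h0, rpow_natCast]; ring
      _ ≤ _ := by gcongr
  have hle := setIntegral_mono_on (integrableOn_mul_V_div_omega_pow
    (measurable_dampingRatio (ε ^ (8 / 5 : ℝ) * p) ε ξ)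
    (fun k => by have := V_nonneg k; positivity)
    (fun k => dampingRatio_le_one hA (V_nonneg k) _) hj)
    (hint.const_mul ((ε ^ (8 / 5 : ℝ) * p) ^ (1 - j / 3 : ℝ) * C ^ (j / 3 : ℝ)))
    measurableSet_Ioc hpt
  rw [integral_const_mul] at hle
  calc dampingPart j ε p ξ ≤ ε ^ ((3 * j - 8) / 5 : ℝ) *
        ((ε ^ (8 / 5 : ℝ) * p) ^ (1 - j / 3 : ℝ) * C ^ (j / 3 : ℝ) *
          ∫ k in Ioc (0 : ℝ) (1 / 2), k ^ (-(4 * j / 9) : ℝ)) :=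
        mul_le_mul_of_nonneg_left hle (rpow_nonneg hε.le _)
    _ = _ := by
      have e : (j / 15 : ℝ) = (3 * j - 8) / 5 + 8 / 5 * (1 - j / 3) := by ring
      rw [mul_rpow (by positivity) hp.le, ← rpow_mul hε.le, e, rpow_add hε]
      ring

theorem tendsto_rpow_nhdsGT_zero {a : ℝ} (ha : 0 < a) :
    Tendsto (fun ε : ℝ => ε ^ a) (𝓝[>] 0) (𝓝[>] 0) := by
  refine tendsto_nhdsWithin_iff.2 ⟨?_, ?_⟩
  · have := (continuousAt_rpow_const (0 : ℝ) a (Or.inr ha.le)).tendsto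
    rw [zero_rpow ha.ne'] at this
    exact this.mono_left nhdsWithin_le_nhds
  · filter_upwards [self_mem_nhdsWithin] with ε hε
    exact rpow_pos_of_pos hε _

theorem tendsto_dampingPart_of_pos {j : ℕ} (hj0 : 0 < j) (hj : j ≤ 2) {p : ℝ} (hp : 0 < p)
    (ξ : ℝ) : Tendsto (fun ε => dampingPart j ε p ξ) (𝓝[>] 0) (𝓝 0) := by
  obtain ⟨K, -, hK⟩ := exists_dampingPart_le hj
  have h1 : Tendsto (fun ε : ℝ => K * p ^ (1 - j / 3 : ℝ) * ε ^ (j / 15 : ℝ)) (𝓝[>] 0)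
      (𝓝 (K * p ^ (1 - j / 3 : ℝ) * 0)) :=
    ((tendsto_rpow_nhdsGT_zero (by positivity)).mono_right nhdsWithin_le_nhds).const_mul _
  rw [mul_zero] at h1
  refine squeeze_zero' ?_ ?_ h1
  · filter_upwards [self_mem_nhdsWithin] with ε hε using (hK ε p ξ hε hp).1
  · filter_upwards [self_mem_nhdsWithin] with ε hε using (hK ε p ξ hε hp).2

/-- The prefactor ε^{-8/5} cancels the ε^{8/5} in A. What remains is p times an integrand bounded by
1 and tending to 1 on an interval of length 1/2. -/
theorem tendsto_dampingPart_zero {p : ℝ} (hp : 0 < p) (ξ : ℝ) :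
    Tendsto (fun ε => dampingPart 0 ε p ξ) (𝓝[>] 0) (𝓝 (p / 2)) := by
  have h1 : Tendsto (fun ε : ℝ => ∫ k in Ioc (0 : ℝ) (1 / 2),
      (ε ^ (8 / 5 : ℝ) * p + V k) /
        ((ε ^ (8 / 5 : ℝ) * p + V k) ^ 2 + (ε * deriv omega k * ξ) ^ 2) * V k) (𝓝[>] 0)
      (𝓝 (∫ _ in Ioc (0 : ℝ) (1 / 2), (1 : ℝ))) := by
    refine tendsto_integral_filter_of_dominated_convergence (fun _ => 1) ?_ ?_ (by simp) ?_
    · refine Eventually.of_forall fun ε => Measurable.aestronglyMeasurable ?_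
      have h1 := measurable_V
      have h2 := measurable_deriv omega
      fun_prop
    · filter_upwards [self_mem_nhdsWithin] with ε hε
      refine ae_of_all _ fun k => ?_
      have hA : 0 < ε ^ (8 / 5 : ℝ) * p := mul_pos (rpow_pos_of_pos hε _) hp
      have hv := V_nonneg k
      rw [norm_of_nonneg (by positivity), div_mul_eq_mul_div, div_le_one (by positivity)]
      nlinarith [mul_nonneg (add_nonneg hA.le hv) hA.le, sq_nonneg (ε * deriv omega k * ξ)]
    · filter_upwards [ae_restrict_mem measurableSet_Ioc] with k hk
      have hv := V_pos hk
      have h8 : Tendsto (fun ε : ℝ => ε ^ (8 / 5 : ℝ)) (𝓝[>] 0) (𝓝 0) :=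
        (tendsto_rpow_nhdsGT_zero (by norm_num)).mono_right nhdsWithin_le_nhds
      have hε : Tendsto (fun ε : ℝ => ε) (𝓝[>] 0) (𝓝 0) := nhdsWithin_le_nhds
      have ha := (h8.mul_const p).add_const (V k)
      have hb := ((hε.mul_const (deriv omega k)).mul_const ξ)
      have := (ha.div ((ha.pow 2).add (hb.pow 2)) (by simp [hv.ne'])).mul_const (V k)
      have hc : (0 * p + V k) / ((0 * p + V k) ^ 2 + (0 * deriv omega k * ξ) ^ 2) * V k = 1 := by
        simp only [zero_mul, zero_add, ne_eq, OfNat.ofNat_ne_zero, not_false_eq_true, zero_pow,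
          add_zero]
        field_simp
      rw [hc] at this
      exact this
  have h2 := h1.const_mul p
  have h3 : p * ∫ _ in Ioc (0 : ℝ) (1 / 2), (1 : ℝ) = p / 2 := by simp; ring
  rw [h3] at h2
  refine h2.congr' ?_
  filter_upwards [self_mem_nhdsWithin] with ε hε
  have hε' : (0 : ℝ) < ε := hε
  have h4 : ε ^ ((3 * (0 : ℕ) - 8) / 5 : ℝ) * ε ^ (8 / 5 : ℝ) = 1 := by
    rw [← rpow_add hε']; norm_num
  rw [dampingPart, ← integral_const_mul, ← integral_const_mul]
  congr 1
  funext k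
  rw [pow_zero, div_one]
  linear_combination (-(p * ((ε ^ (8 / 5 : ℝ) * p + V k) /
    ((ε ^ (8 / 5 : ℝ) * p + V k) ^ 2 + (ε * deriv omega k * ξ) ^ 2) * V k))) * h4

/-! ### The transport part at the scale k ~ ε^{3/5} -/

/-- The integrand of the transport part after the substitution `k = ε ^ (3 / 5) z`. -/
def transportKernel (j : ℕ) (ε p ξ z : ℝ) : ℝ :=
  (Ioc (0 : ℝ) (1 / 2)).indicator (fun k => (ε ^ (3 / 5 : ℝ)) ^ j / ε *
    ((ε * deriv omega k * ξ) ^ 2 /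
      ((ε ^ (8 / 5 : ℝ) * p + V k) ^ 2 + (ε * deriv omega k * ξ) ^ 2) * (V k / omega k ^ j)))
    (ε ^ (3 / 5 : ℝ) * z)

theorem measurable_transportKernel (j : ℕ) (ε p ξ : ℝ) :
    Measurable (transportKernel j ε p ξ) := by
  have h1 := (measurable_transportRatio (ε ^ (8 / 5 : ℝ) * p) ε ξ).mul
    (measurable_V_div_omega_pow j)
  have h2 := (h1.const_mul ((ε ^ (3 / 5 : ℝ)) ^ j / ε)).indicator
    (measurableSet_Ioc (a := (0 : ℝ)) (b := 1 / 2))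
  exact h2.comp (measurable_const_mul _)

theorem transportPart_eq_integral (j : ℕ) {ε : ℝ} (hε : 0 < ε) (p ξ : ℝ) :
    transportPart j ε p ξ = ∫ z in Ioi (0 : ℝ), transportKernel j ε p ξ z := by
  have hδ : 0 < ε ^ (3 / 5 : ℝ) := rpow_pos_of_pos hε _
  unfold transportKernel
  rw [integral_comp_mul_left_Ioi _ 0 hδ, mul_zero, setIntegral_indicator measurableSet_Ioc,
    inter_eq_right.2 Ioc_subset_Ioi_self, integral_const_mul, transportPart, smul_eq_mul,
    ← mul_assoc]
  congr 1
  have e : ((3 * j - 8) / 5 : ℝ) = 3 / 5 * j - 3 / 5 - 1 := by ring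
  rw [e, rpow_sub hε, rpow_sub hε, rpow_mul hε.le, rpow_natCast, rpow_one]
  field_simp

theorem transportKernel_nonneg (j : ℕ) {ε : ℝ} (hε : 0 < ε) (p ξ z : ℝ) :
    0 ≤ transportKernel j ε p ξ z := by
  refine indicator_nonneg (fun k _ => ?_) _
  have h1 := V_nonneg k
  have h2 := omega_nonneg k
  positivity

theorem rpow_three_fifths_rpow {ε : ℝ} (hε : 0 < ε) : (ε ^ (3 / 5 : ℝ)) ^ (5 / 3 : ℝ) = ε := by
  rw [← rpow_mul hε.le]; norm_num

/-- For small z the ratio is bounded by 1 and V ~ k^{5/3} = εz^{5/3} is small; for large z the ratio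
times V is at most B²/V. Together they give an ε-free majorant. -/
theorem exists_transportKernel_le (j : ℕ) : ∃ M₁ M₂ : ℝ, 0 ≤ M₁ ∧ 0 ≤ M₂ ∧
    ∀ ε p ξ z : ℝ, 0 < ε → 0 < p → 0 < z → transportKernel j ε p ξ z ≤
      (M₁ + M₂ * ξ ^ 2) * powerEnvelope (5 / 3 - j) (-(5 / 3) - j) z := by
  obtain ⟨c, C, hc0, hC0, hV⟩ := exists_V_bounds
  have hpi := pi_pos
  refine ⟨C * π ^ (5 / 3 : ℝ), π ^ 2 / c, by positivity, by positivity, ?_⟩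
  intro ε p ξ z hε hp hz
  have henv : 0 ≤ powerEnvelope (5 / 3 - j) (-(5 / 3) - j) z := by
    unfold powerEnvelope; split_ifs <;> positivity
  have hδ : 0 < ε ^ (3 / 5 : ℝ) := rpow_pos_of_pos hε _
  have hA : 0 < ε ^ (8 / 5 : ℝ) * p := mul_pos (rpow_pos_of_pos hε _) hp
  unfold transportKernel
  by_cases hk : ε ^ (3 / 5 : ℝ) * z ∈ Ioc (0 : ℝ) (1 / 2)
  swap
  · rw [indicator_of_notMem hk]; positivity
  rw [indicator_of_mem hk]
  set k := ε ^ (3 / 5 : ℝ) * z with hkdef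
  set B := ε * deriv omega k * ξ with hB
  have hw := omega_pos hk
  have hv := V_pos hk
  have hk53 : k ^ (5 / 3 : ℝ) = ε * z ^ (5 / 3 : ℝ) := by
    rw [hkdef, mul_rpow hδ.le hz.le, rpow_three_fifths_rpow hε]
  have h1 : (ε ^ (3 / 5 : ℝ) / omega k) ^ j ≤ (z ^ j)⁻¹ := by
    rw [← inv_pow]
    refine pow_le_pow_left₀ (by positivity) ?_ j
    rw [div_le_iff₀ hw, ← div_eq_inv_mul, le_div_iff₀ hz]
    linarith [two_mul_le_omega hk.1.le hk.2, hk.1]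
  -- Grouping the powers as (ε^{3/5}/ω)^j removes ε from the weight, since ω ≥ k = ε^{3/5}z.
  have e : (ε ^ (3 / 5 : ℝ)) ^ j / ε * (B ^ 2 / ((ε ^ (8 / 5 : ℝ) * p + V k) ^ 2 + B ^ 2) *
      (V k / omega k ^ j)) = (ε ^ (3 / 5 : ℝ) / omega k) ^ j *
      (B ^ 2 / ((ε ^ (8 / 5 : ℝ) * p + V k) ^ 2 + B ^ 2) * V k / ε) := by
    rw [div_pow]; field_simp
  rw [e]
  have h2 : B ^ 2 / ((ε ^ (8 / 5 : ℝ) * p + V k) ^ 2 + B ^ 2) * V k / ε ≤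
      C * π ^ (5 / 3 : ℝ) * z ^ (5 / 3 : ℝ) := by
    rw [div_le_iff₀ hε]
    calc _ ≤ V k := mul_le_of_le_one_left hv.le (transportRatio_le_one hA hv.le B)
      _ ≤ C * omega k ^ (5 / 3 : ℝ) := (hV k).2
      _ ≤ C * (π * k) ^ (5 / 3 : ℝ) := by gcongr; exact omega_le_pi_mul hk.1.le
      _ = _ := by rw [mul_rpow hpi.le hk.1.le, hk53]; ring
  have h3 : B ^ 2 / ((ε ^ (8 / 5 : ℝ) * p + V k) ^ 2 + B ^ 2) * V k / ε ≤
      π ^ 2 / c * ξ ^ 2 * z ^ (-(5 / 3) : ℝ) := by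
    have hB2 : B ^ 2 ≤ ε ^ 2 * π ^ 2 * ξ ^ 2 := by
      have : (deriv omega k) ^ 2 ≤ π ^ 2 := by
        rw [← sq_abs]; gcongr; exact abs_deriv_omega_le hk
      rw [hB, mul_pow, mul_pow]; gcongr
    have hVk : c * (ε * z ^ (5 / 3 : ℝ)) ≤ V k := by
      rw [← hk53]
      refine le_trans (mul_le_mul_of_nonneg_left ?_ hc0.le) (hV k).1
      exact rpow_le_rpow hk.1.le (by linarith [two_mul_le_omega hk.1.le hk.2, hk.1]) (by norm_num)
    rw [div_le_iff₀ hε]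
    calc _ ≤ B ^ 2 / V k := by
          rw [div_mul_eq_mul_div, div_le_div_iff₀ (by positivity) hv]
          have : V k * V k ≤ (ε ^ (8 / 5 : ℝ) * p + V k) ^ 2 + B ^ 2 := by nlinarith
          calc B ^ 2 * V k * V k = B ^ 2 * (V k * V k) := by ring
            _ ≤ _ := mul_le_mul_of_nonneg_left this (sq_nonneg B)
      _ ≤ ε ^ 2 * π ^ 2 * ξ ^ 2 / (c * (ε * z ^ (5 / 3 : ℝ))) := by gcongr
      _ = _ := by rw [rpow_neg hz.le]; field_simp
  have h4 : 0 ≤ B ^ 2 / ((ε ^ (8 / 5 : ℝ) * p + V k) ^ 2 + B ^ 2) * V k / ε := by positivity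
  rcases le_or_gt z 1 with hz1 | hz1
  · rw [powerEnvelope_of_le hz1, rpow_sub hz, rpow_natCast]
    calc _ ≤ (z ^ j)⁻¹ * (C * π ^ (5 / 3 : ℝ) * z ^ (5 / 3 : ℝ)) := by gcongr
      _ = C * π ^ (5 / 3 : ℝ) * (z ^ (5 / 3 : ℝ) / z ^ j) := by ring
      _ ≤ _ := by
        gcongr
        exact le_add_of_nonneg_right (by positivity)
  · rw [powerEnvelope_of_lt hz1, rpow_sub hz, rpow_natCast]
    calc _ ≤ (z ^ j)⁻¹ * (π ^ 2 / c * ξ ^ 2 * z ^ (-(5 / 3) : ℝ)) := by gcongr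
      _ = π ^ 2 / c * ξ ^ 2 * (z ^ (-(5 / 3) : ℝ) / z ^ j) := by ring
      _ ≤ _ := by
        gcongr
        exact le_add_of_nonneg_left (by positivity)

theorem integrableOn_transportEnvelope {j : ℕ} (hj : j ≤ 2) :
    IntegrableOn (powerEnvelope (5 / 3 - j) (-(5 / 3) - j)) (Ioi 0) := by
  have hj' : (j : ℝ) ≤ 2 := by exact_mod_cast hj
  have : (0 : ℝ) ≤ j := by positivity
  exact integrableOn_powerEnvelope (by linarith) (by linarith)

theorem exists_transportPart_le {j : ℕ} (hj : j ≤ 2) : ∃ M₁ M₂ : ℝ, 0 ≤ M₁ ∧ 0 ≤ M₂ ∧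
    ∀ ε p ξ : ℝ, 0 < ε → 0 < p →
      0 ≤ transportPart j ε p ξ ∧ transportPart j ε p ξ ≤ M₁ + M₂ * ξ ^ 2 := by
  obtain ⟨M₁, M₂, h1, h2, h⟩ := exists_transportKernel_le j
  have hint := integrableOn_transportEnvelope hj
  have hI : 0 ≤ ∫ z in Ioi (0 : ℝ), powerEnvelope (5 / 3 - j) (-(5 / 3) - j) z :=
    setIntegral_nonneg measurableSet_Ioi fun z hz => by
      have : (0 : ℝ) < z := hz
      unfold powerEnvelope; split_ifs <;> positivity
  refine ⟨_, _, mul_nonneg h1 hI, mul_nonneg h2 hI, fun ε p ξ hε hp => ?_⟩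
  rw [transportPart_eq_integral j hε]
  refine ⟨integral_nonneg fun z => transportKernel_nonneg j hε p ξ z, ?_⟩
  calc _ ≤ ∫ z in Ioi (0 : ℝ), (M₁ + M₂ * ξ ^ 2) * powerEnvelope (5 / 3 - j) (-(5 / 3) - j) z := by
        refine integral_mono_of_nonneg
          (ae_of_all _ fun z => transportKernel_nonneg j hε p ξ z) (hint.const_mul _) ?_
        filter_upwards [ae_restrict_mem measurableSet_Ioi] with z hz
        exact h ε p ξ z hε hp hz
    _ = _ := by rw [integral_const_mul]; ring

/-- The pointwise limit of `transportKernel`. -/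
def transportLimit (j : ℕ) (v₀ ξ y : ℝ) : ℝ :=
  (π * |ξ|) ^ 2 / ((v₀ * y ^ (5 / 3 : ℝ)) ^ 2 + (π * |ξ|) ^ 2) * (v₀ * y ^ (5 / 3 : ℝ)) / y ^ j

theorem tendsto_omega_div {z : ℝ} (hz : 0 < z) :
    Tendsto (fun δ : ℝ => omega (δ * z) / δ) (𝓝[>] 0) (𝓝 (π * z)) := by
  have h1 : HasDerivAt (fun δ : ℝ => sin (π * (δ * z))) (cos (π * (0 * z)) * (π * (1 * z))) 0 :=
    (((hasDerivAt_id (0 : ℝ)).mul_const z).const_mul π).sin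
  have h2 := h1.tendsto_slope_zero_right
  simp only [zero_mul, mul_zero, cos_zero, one_mul, zero_add, sin_zero, sub_zero,
    smul_eq_mul] at h2
  refine h2.congr' ?_
  have h3 : Tendsto (fun δ : ℝ => δ * z) (𝓝 0) (𝓝 0) := by
    have := (continuous_id.mul_const z).tendsto (0 : ℝ)
    simpa using this
  have h4 : ∀ᶠ δ : ℝ in 𝓝[>] 0, δ * z < 1 / 2 :=
    (h3.eventually_lt_const (by norm_num)).filter_mono nhdsWithin_le_nhds
  filter_upwards [h4, self_mem_nhdsWithin] with δ hδ hδ0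
  have hδ0' : (0 : ℝ) < δ := hδ0
  rw [omega_of_mem ⟨by positivity, by linarith⟩]
  ring

/-- After dividing V and B by ε, the damping ε^{8/5}p leaves only ε^{3/5}p → 0, while V/ε →
v₀(πz)^{5/3} and B/ε → πξ. -/
theorem tendsto_transportKernel (j : ℕ) (p ξ : ℝ) {z : ℝ} (hz : 0 < z) :
    Tendsto (fun ε => transportKernel j ε p ξ z) (𝓝[>] 0)
      (𝓝 (transportLimit j (rateProfile 0) ξ (π * z))) := by
  have hpi := pi_pos
  have hv0 := rateProfile_zero_pos
  have hδ : Tendsto (fun ε : ℝ => ε ^ (3 / 5 : ℝ)) (𝓝[>] 0) (𝓝[>] 0) :=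
    tendsto_rpow_nhdsGT_zero (by norm_num)
  have hδ0 := hδ.mono_right (nhdsWithin_le_nhds (s := Ioi (0 : ℝ)))
  have hk : Tendsto (fun ε : ℝ => ε ^ (3 / 5 : ℝ) * z) (𝓝[>] 0) (𝓝[>] 0) := by
    refine tendsto_nhdsWithin_iff.2 ⟨?_, ?_⟩
    · simpa using hδ0.mul_const z
    · filter_upwards [self_mem_nhdsWithin] with ε hε
      exact mul_pos (rpow_pos_of_pos hε _) hz
  have hw := (tendsto_omega_div hz).comp hδ
  have hh := tendsto_rateProfile_scaleParam.comp hk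
  have hb : Tendsto (fun ε : ℝ => π * cos (π * (ε ^ (3 / 5 : ℝ) * z)) * ξ) (𝓝[>] 0)
      (𝓝 (π * ξ)) := by
    have h1 : Continuous fun k : ℝ => π * cos (π * k) * ξ := by fun_prop
    have h2 := (h1.tendsto 0).comp (hk.mono_right nhdsWithin_le_nhds)
    simpa [Function.comp_def] using h2
  have hv := (hw.rpow_const (p := (5 / 3 : ℝ)) (Or.inl (by positivity))).mul hh
  have ha := hδ0.mul_const p
  have hden : (0 * p + (π * z) ^ (5 / 3 : ℝ) * rateProfile 0) ^ 2 + (π * ξ) ^ 2 ≠ 0 := by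
    rw [zero_mul, zero_add]; positivity
  have hlim := (((hb.pow 2).div (((ha.add hv).pow 2).add (hb.pow 2)) hden).mul hv).div
    (hw.pow j) (by positivity)
  have e : (π * ξ) ^ 2 / ((0 * p + (π * z) ^ (5 / 3 : ℝ) * rateProfile 0) ^ 2 + (π * ξ) ^ 2) *
      ((π * z) ^ (5 / 3 : ℝ) * rateProfile 0) / (π * z) ^ j =
      transportLimit j (rateProfile 0) ξ (π * z) := by
    rw [transportLimit, mul_pow π |ξ|, sq_abs, ← mul_pow, zero_mul, zero_add,
      mul_comm (rateProfile 0)]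
  rw [e] at hlim
  refine hlim.congr' ?_
  filter_upwards [hk.eventually (Ioc_mem_nhdsGT (show (0 : ℝ) < 1 / 2 by norm_num)),
    self_mem_nhdsWithin] with ε (hmem : ε ^ (3 / 5 : ℝ) * z ∈ Ioc (0 : ℝ) (1 / 2)) hε
  have hε0 : (0 : ℝ) < ε := hε
  have hδp : 0 < ε ^ (3 / 5 : ℝ) := rpow_pos_of_pos hε0 _
  have hwp := omega_pos hmem
  rw [transportKernel, indicator_of_mem hmem]
  simp only [Function.comp, Pi.div_apply]
  rw [deriv_omega_of_mem hmem, V_eq (by rw [abs_of_pos hmem.1]; exact hmem.2),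
    abs_of_pos hmem.1, div_rpow hwp.le hδp.le, rpow_three_fifths_rpow hε0]
  have e8 : ε ^ (8 / 5 : ℝ) = ε * ε ^ (3 / 5 : ℝ) := by
    nth_rewrite 2 [← rpow_one ε]
    rw [← rpow_add hε0]; norm_num
  rw [e8]
  have hh0 : 0 ≤ rateProfile (scaleParam (ε ^ (3 / 5 : ℝ) * z)) :=
    rateProfile_nonneg (scaleParam_mem _)
  generalize omega (ε ^ (3 / 5 : ℝ) * z) ^ (5 / 3 : ℝ) = W
  generalize omega (ε ^ (3 / 5 : ℝ) * z) = w at *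
  generalize rateProfile (scaleParam (ε ^ (3 / 5 : ℝ) * z)) = h at *
  generalize π * cos (π * (ε ^ (3 / 5 : ℝ) * z)) = b
  generalize ε ^ (3 / 5 : ℝ) = δ at *
  have e1 : (ε * δ * p + W * h) ^ 2 + (ε * b * ξ) ^ 2 =
      ε ^ 2 * ((δ * p + W / ε * h) ^ 2 + (b * ξ) ^ 2) := by
    field_simp
  have e2 : (ε * b * ξ) ^ 2 = ε ^ 2 * (b * ξ) ^ 2 := by ring
  rw [e1, e2, mul_div_mul_left _ _ (by positivity), div_pow]
  field_simp

theorem tendsto_transportPart {j : ℕ} (hj : j ≤ 2) {p : ℝ} (hp : 0 < p) (ξ : ℝ) :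
    Tendsto (fun ε => transportPart j ε p ξ) (𝓝[>] 0)
      (𝓝 (∫ z in Ioi (0 : ℝ), transportLimit j (rateProfile 0) ξ (π * z))) := by
  obtain ⟨M₁, M₂, h1, h2, h⟩ := exists_transportKernel_le j
  have hlim : Tendsto (fun ε => ∫ z in Ioi (0 : ℝ), transportKernel j ε p ξ z) (𝓝[>] 0)
      (𝓝 (∫ z in Ioi (0 : ℝ), transportLimit j (rateProfile 0) ξ (π * z))) := by
    refine tendsto_integral_filter_of_dominated_convergence _ ?_ ?_
      ((integrableOn_transportEnvelope hj).const_mul (M₁ + M₂ * ξ ^ 2)) ?_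
    · exact Eventually.of_forall fun ε => (measurable_transportKernel j ε p ξ).aestronglyMeasurable
    · filter_upwards [self_mem_nhdsWithin] with ε hε
      filter_upwards [ae_restrict_mem measurableSet_Ioi] with z hz
      rw [norm_of_nonneg (transportKernel_nonneg j hε p ξ z)]
      exact h ε p ξ z hε hp hz
    · filter_upwards [ae_restrict_mem measurableSet_Ioi] with z hz
      exact tendsto_transportKernel j p ξ hz
  refine hlim.congr' ?_
  filter_upwards [self_mem_nhdsWithin] with ε hε
  rw [transportPart_eq_integral j hε]

/-- The substitution y = (bx)^{3/5} with b = π|ξ|/v₀ makes v₀y^{5/3} equal to π|ξ|x. All parameters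
then factor out of the integral; 6/5 is 2 times the 3/5 from the power substitution. -/
theorem integral_transportLimit (j : ℕ) (hj : j ≤ 2) {v₀ : ℝ} (hv : 0 < v₀) (ξ : ℝ) :
    2 * ∫ z in Ioi (0 : ℝ), transportLimit j v₀ ξ (π * z) =
      6 / 5 * (π / v₀) ^ ((3 - 3 * j) / 5 : ℝ) *
        (∫ z in Ioi (0 : ℝ), z ^ ((3 - 3 * j) / 5 : ℝ) / (z ^ 2 + 1)) *
        |ξ| ^ ((8 - 3 * j) / 5 : ℝ) := by
  have hpi := pi_pos
  have hj' : (j : ℝ) ≤ 2 := by exact_mod_cast hj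
  rcases (abs_nonneg ξ).eq_or_lt with h0 | h0
  · have : ((8 - 3 * j) / 5 : ℝ) ≠ 0 := by linarith
    simp [transportLimit, ← h0, zero_rpow this]
  set b := π * |ξ| / v₀ with hb
  have hb0 : 0 < b := by positivity
  rw [integral_comp_mul_left_Ioi (transportLimit j v₀ ξ) 0 hpi, mul_zero,
    ← integral_comp_rpow_Ioi_of_pos (g := transportLimit j v₀ ξ) (show (0 : ℝ) < 3 / 5 by norm_num)]
  have h1 := integral_comp_mul_left_Ioi (fun x => (3 / 5 * x ^ ((3 / 5 : ℝ) - 1)) •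
    transportLimit j v₀ ξ (x ^ (3 / 5 : ℝ))) 0 hb0
  rw [mul_zero, smul_eq_mul, eq_inv_mul_iff_mul_eq₀ hb0.ne'] at h1
  rw [← h1]
  have h2 : ∀ x ∈ Ioi (0 : ℝ), (3 / 5 * (b * x) ^ ((3 / 5 : ℝ) - 1)) •
      transportLimit j v₀ ξ ((b * x) ^ (3 / 5 : ℝ)) =
      3 / 5 * (π * |ξ|) * b ^ ((3 - 3 * j) / 5 - 1 : ℝ) *
        (x ^ ((3 - 3 * j) / 5 : ℝ) / (x ^ 2 + 1)) := by
    intro x hx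
    have hx0 : (0 : ℝ) < x := hx
    have hbx : 0 < b * x := by positivity
    have e1 : ((b * x) ^ (3 / 5 : ℝ)) ^ (5 / 3 : ℝ) = b * x := rpow_three_fifths_rpow hbx
    have e2 : v₀ * (b * x) = π * |ξ| * x := by rw [hb]; field_simp
    have e3 : ((b * x) ^ (3 / 5 : ℝ)) ^ j = (b * x) ^ (3 * j / 5 : ℝ) := by
      rw [← rpow_natCast, ← rpow_mul hbx.le]; ring_nf
    have e4 : (b * x) ^ ((3 / 5 : ℝ) - 1) / (b * x) ^ (3 * j / 5 : ℝ) =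
        b ^ ((3 - 3 * j) / 5 - 1 : ℝ) * (x ^ ((3 - 3 * j) / 5 : ℝ) / x) := by
      rw [← rpow_sub hbx, mul_rpow hb0.le hx0.le, ← rpow_sub_one hx0.ne']
      ring_nf
    have e5 : (π * |ξ|) ^ 2 / ((π * |ξ| * x) ^ 2 + (π * |ξ|) ^ 2) = 1 / (x ^ 2 + 1) := by
      field_simp
    rw [transportLimit, e1, e2, e3, e5, smul_eq_mul]
    calc _ = 3 / 5 * ((b * x) ^ ((3 / 5 : ℝ) - 1) / (b * x) ^ (3 * j / 5 : ℝ)) *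
          (1 / (x ^ 2 + 1) * (π * |ξ| * x)) := by ring
      _ = _ := by rw [e4]; field_simp
  rw [setIntegral_congr_fun measurableSet_Ioi h2, integral_const_mul, smul_eq_mul,
    rpow_sub_one hb0.ne']
  have e6 : b ^ ((3 - 3 * j) / 5 : ℝ) = (π / v₀) ^ ((3 - 3 * j) / 5 : ℝ) *
      |ξ| ^ ((3 - 3 * j) / 5 : ℝ) := by
    rw [← mul_rpow (by positivity) h0.le, hb]; ring_nf
  have e7 : |ξ| ^ ((8 - 3 * j) / 5 : ℝ) = |ξ| ^ ((3 - 3 * j) / 5 : ℝ) * |ξ| := by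
    rw [← rpow_add_one h0.ne']; ring_nf
  rw [e6, e7]
  field_simp
  ring

/-! ### Pointwise limits of the three symbols -/

theorem tendsto_scaledSymbol {j : ℕ} (hj : j ≤ 2) {x : ℝ × ℝ} (hx : 0 < x.1) {d : ℝ}
    (hd : Tendsto (fun ε => dampingPart j ε x.1 x.2) (𝓝[>] 0) (𝓝 d)) :
    Tendsto (fun ε => scaledSymbol j ε x) (𝓝[>] 0)
      (𝓝 ((-(2 * d) - 6 / 5 * (π / rateProfile 0) ^ ((3 - 3 * j) / 5 : ℝ) *
        (∫ z in Ioi (0 : ℝ), z ^ ((3 - 3 * j) / 5 : ℝ) / (z ^ 2 + 1)) *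
        |x.2| ^ ((8 - 3 * j) / 5 : ℝ) : ℝ) : ℂ)) := by
  rw [← integral_transportLimit j hj rateProfile_zero_pos]
  have h1 := ((hd.add (tendsto_transportPart hj hx x.2)).const_mul 2).neg
  have h2 := (Complex.continuous_ofReal.tendsto _).comp h1
  rw [mul_add, neg_add, ← sub_eq_add_neg] at h2
  refine h2.congr' ?_
  filter_upwards [self_mem_nhdsWithin] with ε hε
  exact (scaledSymbol_eq hε hx hj).symm

theorem tendstoPointwise_a₁ : TendstoPointwise a₁
    (fun x => -x.1 - kappa₁ (rateProfile 0) * |x.2| ^ (8 / 5 : ℝ)) := by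
  intro x hx
  have hx0 : 0 < x.1 := hx.1
  have h := tendsto_scaledSymbol (j := 0) (by norm_num) hx0 (tendsto_dampingPart_zero hx0 x.2)
  simp only [Nat.cast_zero, mul_zero, sub_zero, mul_div_cancel₀ x.1 (two_ne_zero (α := ℝ))] at h
  simp only [a₁_eq_scaledSymbol]
  exact h

theorem tendstoPointwise_a₂ : TendstoPointwise a₂ (fun x => -(kappa₂ * |x.2|)) := by
  intro x hx
  have hx0 : 0 < x.1 := hx.1
  have h := tendsto_scaledSymbol (j := 1) (by norm_num) hx0
    (tendsto_dampingPart_of_pos one_pos (by norm_num) hx0 x.2)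
  have e1 : ((3 - 3 * (1 : ℕ)) / 5 : ℝ) = 0 := by norm_num
  have e2 : ((8 - 3 * (1 : ℕ)) / 5 : ℝ) = 1 := by norm_num
  simp only [e1, e2, rpow_zero, rpow_one, mul_zero, neg_zero, zero_sub, mul_one] at h
  refine h.congr' ?_
  filter_upwards [self_mem_nhdsWithin] with ε hε
  rw [a₂_eq_scaledSymbol hε]

theorem tendstoPointwise_a₃ : TendstoPointwise a₃
    (fun x => -(kappa₃ (rateProfile 0) * |x.2| ^ (2 / 5 : ℝ))) := by
  intro x hx
  have hx0 : 0 < x.1 := hx.1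
  have h := tendsto_scaledSymbol (j := 2) le_rfl hx0
    (tendsto_dampingPart_of_pos two_pos le_rfl hx0 x.2)
  have e1 : ((3 - 3 * (2 : ℕ)) / 5 : ℝ) = -(3 / 5) := by norm_num
  have e2 : ((8 - 3 * (2 : ℕ)) / 5 : ℝ) = 2 / 5 := by norm_num
  have e3 : (π / rateProfile 0) ^ (-(3 / 5) : ℝ) = (rateProfile 0 / π) ^ (3 / 5 : ℝ) := by
    rw [rpow_neg (div_nonneg pi_pos.le rateProfile_zero_pos.le),
      ← inv_rpow (div_nonneg pi_pos.le rateProfile_zero_pos.le), inv_div]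
  simp only [e1, e2, e3, mul_zero, neg_zero, zero_sub] at h
  refine h.congr' ?_
  filter_upwards [self_mem_nhdsWithin] with ε hε
  rw [a₃_eq_scaledSymbol hε]

/-! ### Uniform bounds on compact sets and convergence in L^q_loc -/

/-- Boundedness on compact sets, uniformly in `ε > 0`, everywhere rather than almost everywhere. -/
def UniformlyBoundedOnCompacts (a : ℝ → ℝ × ℝ → ℂ) : Prop :=
  ∀ K : Set (ℝ × ℝ), IsCompact K → K ⊆ domain → ∃ C : ℝ, ∀ ε > 0, ∀ x ∈ K, ‖a ε x‖ ≤ C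

theorem uniformlyBoundedOnCompacts_scaledSymbol {j : ℕ} (hj : j ≤ 2) :
    UniformlyBoundedOnCompacts (scaledSymbol j) := by
  intro K hK hKd
  obtain ⟨R, hR⟩ := hK.isBounded.exists_norm_le
  obtain ⟨N, hN0, hN⟩ := exists_dampingPart_le hj
  obtain ⟨M₁, M₂, hM₁, hM₂, hM⟩ := exists_transportPart_le hj
  have hj' : (j : ℝ) ≤ 2 := by exact_mod_cast hj
  -- The first entry serves ε ≥ 1. The second serves ε ≤ 1, where ε^{j/15} ≤ 1 and both p and |ξ|
  -- are at most R.
  refine ⟨max (∫ k in (-(1 / 2) : ℝ)..(1 / 2), 2 * (V k / omega k ^ j))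
    (2 * (N * R ^ (1 - j / 3 : ℝ) + (M₁ + M₂ * R ^ 2))), fun ε hε x hx => ?_⟩
  have hx0 : 0 < x.1 := (hKd hx).1
  rcases le_total 1 ε with h1 | h1
  · exact (norm_scaledSymbol_le_of_one_le h1 hx0 hj).trans (le_max_left _ _)
  refine le_trans ?_ (le_max_right _ _)
  have hp : x.1 ≤ R := (le_abs_self _).trans ((norm_fst_le x).trans (hR x hx))
  have hξ : |x.2| ≤ R := (norm_snd_le x).trans (hR x hx)
  obtain ⟨d0, d1⟩ := hN ε x.1 x.2 hε hx0
  obtain ⟨t0, t1⟩ := hM ε x.1 x.2 hε hx0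
  rw [scaledSymbol_eq hε hx0 hj, Complex.norm_real, norm_neg, norm_of_nonneg (by positivity)]
  have h2 : x.1 ^ (1 - j / 3 : ℝ) ≤ R ^ (1 - j / 3 : ℝ) :=
    rpow_le_rpow hx0.le hp (by linarith)
  have h3 : ε ^ (j / 15 : ℝ) ≤ 1 := rpow_le_one hε.le h1 (by positivity)
  have h4 : x.2 ^ 2 ≤ R ^ 2 := by rw [← sq_abs]; gcongr
  have h5 : N * x.1 ^ (1 - j / 3 : ℝ) * ε ^ (j / 15 : ℝ) ≤ N * R ^ (1 - j / 3 : ℝ) :=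
    (mul_le_of_le_one_right (by positivity) h3).trans (by gcongr)
  have h6 : M₂ * x.2 ^ 2 ≤ M₂ * R ^ 2 := by gcongr
  linarith

theorem UniformlyBoundedOnCompacts.congr {a b : ℝ → ℝ × ℝ → ℂ}
    (h : UniformlyBoundedOnCompacts b) (hab : ∀ ε > 0, a ε = b ε) :
    UniformlyBoundedOnCompacts a := by
  intro K hK hKd
  obtain ⟨C, hC⟩ := h K hK hKd
  exact ⟨C, fun ε hε x hx => by rw [hab ε hε]; exact hC ε hε x hx⟩

theorem UniformlyBoundedOnCompacts.uniformlyLocBounded {a : ℝ → ℝ × ℝ → ℂ}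
    (h : UniformlyBoundedOnCompacts a) (hm : ∀ ε > 0, StronglyMeasurable (a ε)) :
    UniformlyLocBounded a := by
  intro K hK hKd
  obtain ⟨C, hC⟩ := h K hK hKd
  refine ⟨C, fun ε hε => ?_⟩
  have hae : ∀ᵐ x ∂volume.restrict K, ‖a ε x‖ ≤ C := by
    filter_upwards [ae_restrict_mem hK.measurableSet] with x hx using hC ε hε x hx
  refine ⟨memLp_top_of_bound (hm ε hε).aestronglyMeasurable C hae, ?_⟩
  rw [eLpNorm_exponent_top]
  exact eLpNormEssSup_le_of_ae_bound hae

/-- Dominated convergence on a set of finite measure, with a constant majorant; the limit inherits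
the bound C from pointwise convergence. -/
theorem UniformlyBoundedOnCompacts.tendstoLocLq {a : ℝ → ℝ × ℝ → ℂ} {l : ℝ × ℝ → ℝ}
    (h : UniformlyBoundedOnCompacts a) (hm : ∀ ε > 0, StronglyMeasurable (a ε))
    (hl : Measurable l) (ht : TendstoPointwise a l) {q : ℝ≥0∞} (hq0 : q ≠ 0) (hq : q ≠ ∞) :
    TendstoLocLq q a l := by
  intro K hK hKd
  obtain ⟨C, hC⟩ := h K hK hKd
  have hfin : IsFiniteMeasure (volume.restrict K) := ⟨by
    rw [Measure.restrict_apply_univ]; exact hK.measure_lt_top⟩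
  have hq' : 0 < q.toReal := ENNReal.toReal_pos hq0 hq
  have hl' : Measurable fun x => (l x : ℂ) := Complex.measurable_ofReal.comp hl
  have hlC : ∀ x ∈ K, ‖(l x : ℂ)‖ ≤ C := fun x hx =>
    le_of_tendsto (ht x (hKd hx)).norm (by
      filter_upwards [self_mem_nhdsWithin] with ε hε using hC ε hε x hx)
  refine ⟨fun ε hε => MemLp.of_bound (hm ε hε).aestronglyMeasurable C ?_,
    MemLp.of_bound hl'.aestronglyMeasurable C ?_, ?_⟩
  · filter_upwards [ae_restrict_mem hK.measurableSet] with x hx using hC ε hε x hx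
  · filter_upwards [ae_restrict_mem hK.measurableSet] with x hx using hlC x hx
  have hlim : Tendsto (fun ε => ∫⁻ x in K, ‖a ε x - (l x : ℂ)‖ₑ ^ q.toReal) (𝓝[>] 0)
      (𝓝 (∫⁻ _ in K, 0)) := by
    refine tendsto_lintegral_filter_of_dominated_convergence
      (fun _ => ENNReal.ofReal (C + C) ^ q.toReal) ?_ ?_ ?_ ?_
    · filter_upwards [self_mem_nhdsWithin] with ε hε
      exact (((hm ε hε).measurable.sub hl').enorm).pow_const _
    · filter_upwards [self_mem_nhdsWithin] with ε hε
      filter_upwards [ae_restrict_mem hK.measurableSet] with x hx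
      refine ENNReal.rpow_le_rpow ?_ hq'.le
      rw [← ofReal_norm]
      exact ENNReal.ofReal_le_ofReal
        ((norm_sub_le _ _).trans (add_le_add (hC ε hε x hx) (hlC x hx)))
    · rw [lintegral_const]
      exact ENNReal.mul_ne_top (ENNReal.rpow_ne_top_of_nonneg hq'.le ENNReal.ofReal_ne_top)
        (measure_ne_top _ _)
    · filter_upwards [ae_restrict_mem hK.measurableSet] with x hx
      have h1 : Tendsto (fun ε => a ε x - (l x : ℂ)) (𝓝[>] 0) (𝓝 0) := by
        simpa using (ht x (hKd hx)).sub_const (l x : ℂ)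
      have h2 := (h1.enorm).ennrpow_const q.toReal
      simpa [hq'] using h2
  rw [lintegral_zero] at hlim
  have h3 := hlim.ennrpow_const (1 / q.toReal)
  rw [ENNReal.zero_rpow_of_pos (by positivity)] at h3
  simpa only [eLpNorm_eq_lintegral_rpow_enorm_toReal hq0 hq] using h3

theorem integrableOn_rpow_div_sq_add_one {a : ℝ} (h0 : -1 < a) (h1 : a < 1) :
    IntegrableOn (fun z : ℝ => z ^ a / (z ^ 2 + 1)) (Ioi 0) := by
  refine Integrable.mono' (integrableOn_powerEnvelope h0 (show a - 2 < -1 by linarith))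
    (by fun_prop : Measurable fun z : ℝ => z ^ a / (z ^ 2 + 1)).aestronglyMeasurable ?_
  filter_upwards [ae_restrict_mem measurableSet_Ioi] with z hz
  have hz0 : (0 : ℝ) < z := hz
  rw [norm_of_nonneg (by positivity)]
  rcases le_or_gt z 1 with h | h
  · rw [powerEnvelope_of_le h]
    exact div_le_self (by positivity) (by nlinarith)
  · rw [powerEnvelope_of_lt h, rpow_sub hz0, rpow_two]
    gcongr
    linarith

theorem uniformlyBoundedOnCompacts_a₁ : UniformlyBoundedOnCompacts a₁ :=
  (uniformlyBoundedOnCompacts_scaledSymbol (j := 0) (by norm_num)).congr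
    fun ε _ => a₁_eq_scaledSymbol ε

theorem uniformlyBoundedOnCompacts_a₂ : UniformlyBoundedOnCompacts a₂ :=
  (uniformlyBoundedOnCompacts_scaledSymbol (j := 1) (by norm_num)).congr
    fun _ hε => a₂_eq_scaledSymbol hε

theorem uniformlyBoundedOnCompacts_a₃ : UniformlyBoundedOnCompacts a₃ :=
  (uniformlyBoundedOnCompacts_scaledSymbol (j := 2) le_rfl).congr
    fun _ hε => a₃_eq_scaledSymbol hε

theorem stronglyMeasurable_a₁ : ∀ ε > 0, StronglyMeasurable (a₁ ε) := fun ε _ => by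
  rw [a₁_eq_scaledSymbol]; exact stronglyMeasurable_scaledSymbol 0 ε

theorem stronglyMeasurable_a₂ : ∀ ε > 0, StronglyMeasurable (a₂ ε) := fun ε hε => by
  rw [a₂_eq_scaledSymbol hε]; exact stronglyMeasurable_scaledSymbol 1 ε

theorem stronglyMeasurable_a₃ : ∀ ε > 0, StronglyMeasurable (a₃ ε) := fun ε hε => by
  rw [a₃_eq_scaledSymbol hε]; exact stronglyMeasurable_scaledSymbol 2 ε

end PhononSymbol

end

theorem mainTheorem3 :
    -- the collision frequency is finite, and the integrals below converge absolutely
    (∀ k : ℝ, PhononSymbol.collisionRate k ≠ ∞) ∧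
    (∀ ε p ξ : ℝ, 0 < ε → 0 < p → ∀ j : ℕ, j ≤ 2 →
      IntervalIntegrable (fun k => PhononSymbol.defect ε p ξ k *
        ((PhononSymbol.V k / PhononSymbol.omega k ^ j : ℝ) : ℂ)) volume (-(1 / 2)) (1 / 2)) ∧
    IntegrableOn (fun z : ℝ => z ^ (3 / 5 : ℝ) / (z ^ 2 + 1)) (Ioi 0) ∧
    IntegrableOn (fun z : ℝ => 1 / (z ^ 2 + 1)) (Ioi 0) ∧
    IntegrableOn (fun z : ℝ => z ^ (-(3 / 5) : ℝ) / (z ^ 2 + 1)) (Ioi 0) ∧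
    -- `v₀` is the limit of `|sin (π k)|^{-5/3} V(k)` as `k → 0`
    (∃ v₀ : ℝ, 0 < v₀ ∧
      Tendsto (fun k : ℝ => |sin (π * k)| ^ (-(5 / 3) : ℝ) * PhononSymbol.V k)
        (𝓝[≠] 0) (𝓝 v₀) ∧
      -- pointwise convergence
      PhononSymbol.TendstoPointwise PhononSymbol.a₁
        (fun x => -x.1 - PhononSymbol.kappa₁ v₀ * |x.2| ^ (8 / 5 : ℝ)) ∧
      PhononSymbol.TendstoPointwise PhononSymbol.a₂
        (fun x => -(PhononSymbol.kappa₂ * |x.2|)) ∧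
      PhononSymbol.TendstoPointwise PhononSymbol.a₃
        (fun x => -(PhononSymbol.kappa₃ v₀ * |x.2| ^ (2 / 5 : ℝ))) ∧
      -- strong convergence in `L^q_loc` for all `1 < q < ∞`
      (∀ q : ℝ≥0∞, 1 < q → q < ∞ →
        PhononSymbol.TendstoLocLq q PhononSymbol.a₁
          (fun x => -x.1 - PhononSymbol.kappa₁ v₀ * |x.2| ^ (8 / 5 : ℝ)) ∧
        PhononSymbol.TendstoLocLq q PhononSymbol.a₂
          (fun x => -(PhononSymbol.kappa₂ * |x.2|)) ∧
        PhononSymbol.TendstoLocLq q PhononSymbol.a₃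
          (fun x => -(PhononSymbol.kappa₃ v₀ * |x.2| ^ (2 / 5 : ℝ))))) ∧
    -- local boundedness, uniformly in `ε`
    PhononSymbol.UniformlyLocBounded PhononSymbol.a₁ ∧
    PhononSymbol.UniformlyLocBounded PhononSymbol.a₂ ∧
    PhononSymbol.UniformlyLocBounded PhononSymbol.a₃ := by
  refine ⟨PhononSymbol.collisionRate_ne_top,
    fun ε p ξ hε hp j hj => PhononSymbol.intervalIntegrable_defect_mul hε hp ξ hj,
    PhononSymbol.integrableOn_rpow_div_sq_add_one (by norm_num) (by norm_num), ?_,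
    PhononSymbol.integrableOn_rpow_div_sq_add_one (by norm_num) (by norm_num),
    ⟨PhononSymbol.rateProfile 0, PhononSymbol.rateProfile_zero_pos,
      PhononSymbol.tendsto_V_div_omega, PhononSymbol.tendstoPointwise_a₁,
      PhononSymbol.tendstoPointwise_a₂, PhononSymbol.tendstoPointwise_a₃, fun q hq1 hq => ?_⟩,
    PhononSymbol.uniformlyBoundedOnCompacts_a₁.uniformlyLocBounded
      PhononSymbol.stronglyMeasurable_a₁,
    PhononSymbol.uniformlyBoundedOnCompacts_a₂.uniformlyLocBounded
      PhononSymbol.stronglyMeasurable_a₂,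
    PhononSymbol.uniformlyBoundedOnCompacts_a₃.uniformlyLocBounded
      PhononSymbol.stronglyMeasurable_a₃⟩
  · simpa using PhononSymbol.integrableOn_rpow_div_sq_add_one (a := 0) (by norm_num) (by norm_num)
  · have hq0 : q ≠ 0 := (zero_lt_one.trans hq1).ne'
    have habs : Measurable fun x : ℝ × ℝ => |x.2| := by fun_prop
    exact ⟨PhononSymbol.uniformlyBoundedOnCompacts_a₁.tendstoLocLq
        PhononSymbol.stronglyMeasurable_a₁ (by fun_prop) PhononSymbol.tendstoPointwise_a₁ hq0 hq.ne,
      PhononSymbol.uniformlyBoundedOnCompacts_a₂.tendstoLocLq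
        PhononSymbol.stronglyMeasurable_a₂ (by fun_prop) PhononSymbol.tendstoPointwise_a₂ hq0 hq.ne,
      PhononSymbol.uniformlyBoundedOnCompacts_a₃.tendstoLocLq
        PhononSymbol.stronglyMeasurable_a₃ (by fun_prop) PhononSymbol.tendstoPointwise_a₃ hq0 hq.ne⟩
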